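/- **Conventions.** An associative calculus is a finite semigroup presentation: a finite alphabet together with finitely many defining relations between nonempty words; $u\equiv w$ means that $w$ can be obtained from $u$ by finitely many replacements of an occurrence of one side of a defining relation by the other side. Its word problem is the decision problem whether $u\equiv w$ for given words $u,w$. A Turing machine $\mathfrak T$ has tape symbols $a_0,\dots,a_m$ ($m\ge 1$; $a_0=0$ is the blank, $a_1=1$), states $q_0,\dots,q_n$ ($n\ge1$; $q_1$ is initial, $q_0$ is final and no instruction begins with it), and for each pair $(q_\alpha,a_i)$ at most one instruction, of the form $q_\alpha a_i\to q_\beta a_j$ (print), $q_\alpha a_i\to q_\beta L$ or $q_\alpha a_i\to q_\beta R$ (move the head one cell). Its tape is finite and is extended by a blank cell whenever the head leaves it on the left or on the right; the machine stops when no instruction applies. $\mathfrak T$ computes the partial function $E$ on $\mathbb N$ if for each $x$ with $E(x)$ defined it passes from the configuration $q_1 01^x$ to $q_0 01^{E(x)}0^s$ for some $s\ge 0$ without extending the tape to the left, and for each $x$ with $E(x)$ undefined, started in $q_1 01^x$, it never stops. $A(\mathfrak T)$ is the associative calculus with alphabet $a_0,\dots,a_m,q_0,\dots,q_n,v$ and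 the defining relations $q_\alpha a_i\equiv q_\beta a_j$ for each instruction $q_\alpha a_i\to q_\beta a_j$; $a_kq_\alpha a_i\equiv q_\beta a_ka_i$ ($k=0,\dots,m$) for each instruction $q_\alpha a_i\to q_\beta L$; $q_\alpha a_i\equiv a_iq_\beta$ for each instruction $q_\alpha a_i\to q_\beta R$; and $a_0v\equiv v$. **Theorem (Post, Markov).** 1. Let $E$ be a partial recursive function with values in $\{0,1\}$ that has no total recursive extension, let $M_i=\{x\mid E(x)=i\}$ for $i=0,1$, and let $\mathfrak T$ be a Turing machine that computes $E$. Then $M_0$ and $M_1$ are recursively enumerable and not recursive; in $A(\mathfrak T)$, for all $x\in\mathbb N$ and $i\in\{0,1\}$, $$q_1 01^x v\equiv q_0 01^i v\iff x\in M_i;$$ and the word problem of $A(\mathfrak T)$ is algorithmically undecidable. 2. Such a function $E$ and a Turing machine $\mathfrak T$ computing it exist. 3. Hence there exists an associative calculus with an algorithmically undecidable word problem. -/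

import Mathlib

/-! ### Associative calculi (finite semigroup presentations) -/

/-- An associative calculus over the alphabet `α`: a finite set of defining relations `l ≡ r`
between nonempty words, i.e. a semigroup presentation with finitely many relations. -/
structure AssociativeCalculus (α : Type) where
  rels : Set (List α × List α)
  finite_rels : rels.Finite
  ne_nil : ∀ p ∈ rels, p.1 ≠ [] ∧ p.2 ≠ []

namespace AssociativeCalculus

variable {α : Type}

/-- One elementary transformation: an occurrence of the left side of a defining relation
is replaced by the right side. -/
inductive Rewrite (C : AssociativeCalculus α) : List α → List α → Prop
  | intro (s t l r : List α) (h : (l, r) ∈ C.rels) : Rewrite C (s ++ l ++ t) (s ++ r ++ t)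

/-- Equivalence of words, `u ≡ w` in `C`: a finite chain of elementary transformations,
each used in either direction, leads from `u` to `w`. -/
def Equivalent (C : AssociativeCalculus α) : List α → List α → Prop :=
  Relation.EqvGen C.Rewrite

/-- The word problem of `C` is algorithmically decidable. (The empty word is equivalent only to
itself, so it makes no difference whether it is admitted as an input.) -/
def WordProblemDecidable [Primcodable α] (C : AssociativeCalculus α) : Prop :=
  ComputablePred fun p : List α × List α => C.Equivalent p.1 p.2

/-- Equivalence of words is the least congruence on the free monoid of words that contains
the defining relations. -/
theorem equivalent_iff_conGen (C : AssociativeCalculus α) (u w : FreeMonoid α) :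
    C.Equivalent u.toList w.toList ↔
      conGen (fun a b : FreeMonoid α => (a.toList, b.toList) ∈ C.rels) u w := by
  have ctx : ∀ {x y : List α}, C.Equivalent x y → ∀ s t : List α,
      C.Equivalent (s ++ x ++ t) (s ++ y ++ t) := by
    intro x y h s t
    induction h with
    | rel x y h =>
      obtain ⟨s', t', l, r, hlr⟩ := h
      have h1 := Rewrite.intro (C := C) (s ++ s') (t' ++ t) l r hlr
      simp only [List.append_assoc] at h1 ⊢
      exact Relation.EqvGen.rel _ _ h1
    | refl x => exact Relation.EqvGen.refl _
    | symm x y _ ih => exact Relation.EqvGen.symm _ _ ih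
    | trans x y z _ _ ih1 ih2 => exact Relation.EqvGen.trans _ _ _ ih1 ih2
  constructor
  · intro h
    have key : ∀ x y : List α, C.Equivalent x y →
        conGen (fun a b : FreeMonoid α => (a.toList, b.toList) ∈ C.rels)
          (FreeMonoid.ofList x) (FreeMonoid.ofList y) := by
      intro x y h
      induction h with
      | rel x y h =>
        obtain ⟨s, t, l, r, hlr⟩ := h
        simp only [FreeMonoid.ofList_append]
        exact Con.mul _ (Con.mul _ (Con.refl _ _) (ConGen.Rel.of _ _ hlr)) (Con.refl _ _)
      | refl x => exact Con.refl _ _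
      | symm x y _ ih => exact Con.symm _ ih
      | trans x y z _ _ ih1 ih2 => exact Con.trans _ ih1 ih2
    exact key _ _ h
  · intro h
    change ConGen.Rel _ u w at h
    induction h with
    | of x y h =>
      have h1 := Rewrite.intro (C := C) [] [] _ _ h
      simp only [List.nil_append, List.append_nil] at h1
      exact Relation.EqvGen.rel _ _ h1
    | refl x => exact Relation.EqvGen.refl _
    | symm _ ih => exact Relation.EqvGen.symm _ _ ih
    | trans _ _ ih1 ih2 => exact Relation.EqvGen.trans _ _ _ ih1 ih2
    | @mul w x y z _ _ ih1 ih2 =>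
      have h1 := ctx ih1 [] y.toList
      have h2 := ctx ih2 x.toList []
      simp only [List.nil_append, List.append_nil] at h1 h2
      exact Relation.EqvGen.trans _ _ _ h1 h2

end AssociativeCalculus

/-! ### Turing machines -/

/-- A (deterministic) Turing machine with tape symbols `a_0, …, a_{m+1}`, where `a_0 = 0` is the
blank and `a_1 = 1`, and states `q_0, …, q_{n+1}`, where `q_1` is the initial and `q_0` the final
state. The value of the program at `(q, a)` is the instruction with left side `q a`, if there is
one; it either prints a symbol or moves the head one cell, and passes to a new state. -/
structure TuringMachine (m n : ℕ) where
  program : Fin (n + 2) → Fin (m + 2) →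
    Option (Fin (n + 2) × Turing.TM0.Stmt (Fin (m + 2)))
  program_final : ∀ a, program 0 a = none

namespace TuringMachine

variable {m n : ℕ}

/-- The configuration `left.reverse q head right`: the finite tape consists of the cells to the
left of the scanned cell (listed from the nearest one), the scanned cell and the cells to the right
of it (listed from the nearest one). -/
structure Config (m n : ℕ) where
  left : List (Fin (m + 2))
  state : Fin (n + 2)
  head : Fin (m + 2)
  right : List (Fin (m + 2))

/-- One step of the machine that does not extend the tape to the left. -/
inductive StepNoExt (T : TuringMachine m n) : Config m n → Config m n → Prop
  | print {q a q' b} (u w : List (Fin (m + 2))) (h : T.program q a = some (q', .write b)) :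
      StepNoExt T ⟨u, q, a, w⟩ ⟨u, q', b, w⟩
  | moveRight {q a q'} (u : List (Fin (m + 2))) (b : Fin (m + 2)) (w : List (Fin (m + 2)))
      (h : T.program q a = some (q', .move .right)) :
      StepNoExt T ⟨u, q, a, b :: w⟩ ⟨a :: u, q', b, w⟩
  | extendRight {q a q'} (u : List (Fin (m + 2)))
      (h : T.program q a = some (q', .move .right)) :
      StepNoExt T ⟨u, q, a, []⟩ ⟨a :: u, q', 0, []⟩
  | moveLeft {q a q'} (c : Fin (m + 2)) (u w : List (Fin (m + 2)))
      (h : T.program q a = some (q', .move .left)) :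
      StepNoExt T ⟨c :: u, q, a, w⟩ ⟨u, q', c, a :: w⟩

/-- One step of the machine: when the head leaves the tape on the left, a blank cell is added
there. -/
inductive Step (T : TuringMachine m n) : Config m n → Config m n → Prop
  | noExt {c d} (h : T.StepNoExt c d) : Step T c d
  | extendLeft {q a q'} (w : List (Fin (m + 2))) (h : T.program q a = some (q', .move .left)) :
      Step T ⟨[], q, a, w⟩ ⟨[], q', 0, a :: w⟩

/-- The machine stops in this configuration: no instruction applies. -/
def Halted (T : TuringMachine m n) (c : Config m n) : Prop :=
  T.program c.state c.head = none

/-- The initial configuration `q_1 0 1^x`. -/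
def initial (m n x : ℕ) : Config m n :=
  ⟨[], 1, 0, List.replicate x 1⟩

/-- The final configuration `q_0 0 1^y 0^s`. -/
def final (m n y s : ℕ) : Config m n :=
  ⟨[], 0, 0, List.replicate y 1 ++ List.replicate s 0⟩

/-- `T` computes the partial function `E`: if `E x = y`, then `T` passes from `q_1 0 1^x` to
`q_0 0 1^y 0^s` for some `s` without extending the tape to the left; if `E x` is undefined,
then `T`, started in `q_1 0 1^x`, never stops. -/
def Computes (T : TuringMachine m n) (E : ℕ →. ℕ) : Prop :=
  ∀ x : ℕ,
    (∀ y ∈ E x, ∃ s : ℕ, Relation.ReflTransGen T.StepNoExt (initial m n x) (final m n y s)) ∧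
    (¬ (E x).Dom → ∀ c, Relation.ReflTransGen T.Step (initial m n x) c → ¬ T.Halted c)

/-! ### The associative calculus of a Turing machine -/

/-- The alphabet `a_0, …, a_{m+1}, q_0, …, q_{n+1}, v`. -/
abbrev Letter (m n : ℕ) : Type := Fin (m + 2) ⊕ Fin (n + 2) ⊕ Unit

/-- The letter `a_i`. -/
def sym (i : Fin (m + 2)) : Letter m n := Sum.inl i

/-- The letter `q_i`. -/
def st (i : Fin (n + 2)) : Letter m n := Sum.inr (Sum.inl i)

/-- The letter `v`. -/
def endMark : Letter m n := Sum.inr (Sum.inr ())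

/-- The defining relations of `A(T)`. -/
inductive DefiningRel (T : TuringMachine m n) : List (Letter m n) → List (Letter m n) → Prop
  | print {q a q' b} (h : T.program q a = some (q', .write b)) :
      DefiningRel T [st q, sym a] [st q', sym b]
  | left {q a q'} (h : T.program q a = some (q', .move .left)) (c : Fin (m + 2)) :
      DefiningRel T [sym c, st q, sym a] [st q', sym c, sym a]
  | right {q a q'} (h : T.program q a = some (q', .move .right)) :
      DefiningRel T [st q, sym a] [sym a, st q']
  | blank : DefiningRel T [sym 0, endMark] [endMark]

/-- The associative calculus `A(T)`. -/
def calculus (T : TuringMachine m n) : AssociativeCalculus (Letter m n) where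
  rels := {p | T.DefiningRel p.1 p.2}
  finite_rels := by
    refine ((List.finite_length_le (Letter m n) 3).prod
      (List.finite_length_le (Letter m n) 3)).subset ?_
    rintro ⟨l, r⟩ h
    cases h <;> simp
  ne_nil := by
    rintro ⟨l, r⟩ h
    cases h <;> simp

/-- The word `q_k 0 1^x v`. -/
def word (m : ℕ) {n : ℕ} (k : Fin (n + 2)) (x : ℕ) : List (Letter m n) :=
  [st k, sym 0] ++ List.replicate x (sym 1) ++ [endMark]

end TuringMachine

/-- `E` is a partial recursive function with values in `{0, 1}` that has no (total) recursive
extension. -/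
structure IsInextensible (E : ℕ →. ℕ) : Prop where
  partrec : Partrec E
  zero_or_one : ∀ x, ∀ y ∈ E x, y = 0 ∨ y = 1
  no_extension : ¬ ∃ f : ℕ → ℕ, Computable f ∧ ∀ x, ∀ y ∈ E x, f x = y

/-! A step that does not extend the tape to the left is an application of a defining relation to the
word of the configuration, with `a_0 v ≡ v` creating blanks on the right and removing them at the
end. So a computation yields an equivalence (`equivalent_of_computes`).

The converse has to show that relations used backwards connect nothing new. Words are read from
right to left and evaluated to configurations on a tape that is infinite to the right; all misshapen
words share an absorbing value. On values, `a_0 v ≡ v` becomes an equality and every other relation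
becomes an equality or one machine step. This step relation is deterministic, so equivalent values
have a common reduct. A value in the final state is irreducible and hence is reached by forward
steps alone, which lift to a genuine computation (`mem_of_equivalent`).

If `M_i` were recursive, the function with value `i` on `M_i` and `1 - i` elsewhere would be a
recursive extension of `E`. Since `M_0` reduces to the word problem, that problem is undecidable.

For existence, `E x` is `1 - φ_x(x)`, a diagonal function. It is an unbounded search with a
primitive recursive test. Primitive recursive functions are computed by loop programs on registers
(`exists_computesInto`), programs are compiled to register machines, and these are simulated with
the registers in unary on parallel tracks of one tape (`RegInstr.Step.simLeads`). Every simulated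
step costs at least one Turing step, so a search without success makes the Turing machine run
forever. -/

/-! ### Deterministic relations -/

namespace Relation

variable {α : Type*} {r : α → α → Prop}

/-- Elements equivalent under a deterministic relation have a common reduct. -/
theorem EqvGen.join_of_deterministic (hr : ∀ a b c, r a b → r a c → b = c) {a b : α}
    (h : EqvGen r a b) : Join (ReflTransGen r) a b := by
  have heq : Equivalence (Join (ReflTransGen r)) := by
    refine equivalence_join_reflTransGen fun a b c hb hc => ?_
    obtain rfl := hr a b c hb hc
    exact ⟨b, .refl, .refl⟩
  rw [← heq.eqvGen_iff]
  exact h.mono fun x y hxy => ⟨y, .single hxy, .refl⟩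

/-- An element equivalent to an irreducible one under a deterministic relation reduces to it. -/
theorem EqvGen.reflTransGen_of_irreducible (hr : ∀ a b c, r a b → r a c → b = c) {a b : α}
    (h : EqvGen r a b) (hb : ∀ c, ¬ r b c) : ReflTransGen r a b := by
  obtain ⟨c, hac, hbc⟩ := h.join_of_deterministic hr
  rcases hbc.cases_head with rfl | ⟨d, hd, -⟩
  · exact hac
  · exact (hb d hd).elim

end Relation

namespace AssociativeCalculus

variable {α : Type} {C : AssociativeCalculus α}

theorem Equivalent.refl (u : List α) : C.Equivalent u u :=
  Relation.EqvGen.refl u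

theorem Equivalent.symm {u w : List α} (h : C.Equivalent u w) : C.Equivalent w u :=
  Relation.EqvGen.symm _ _ h

theorem Equivalent.trans {u w z : List α} (h : C.Equivalent u w) (h' : C.Equivalent w z) :
    C.Equivalent u z :=
  Relation.EqvGen.trans _ _ _ h h'

theorem Equivalent.of_rel {l r : List α} (h : (l, r) ∈ C.rels) (s t : List α) :
    C.Equivalent (s ++ l ++ t) (s ++ r ++ t) :=
  .rel _ _ (.intro s t l r h)

end AssociativeCalculus

/-! ### Determinism of Turing machines -/

namespace TuringMachine

variable {m n : ℕ} {T : TuringMachine m n}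

theorem Step.deterministic {c d d' : Config m n} (h : T.Step c d) (h' : T.Step c d') :
    d = d' := by
  rcases h with h | _
  · rcases h with _ | _ | _ | _ <;> rcases h' with h' | _ <;> (try rcases h' with _ | _ | _ | _) <;>
      simp_all
  · rcases h' with h' | _
    · rcases h' with _ | _ | _ | _ <;> simp_all
    · simp_all

theorem Step.not_halted {c d : Config m n} (h : T.Step c d) : ¬ T.Halted c := by
  rcases h with h | _
  · rcases h with _ | _ | _ | _ <;> simp_all [Halted]
  · simp_all [Halted]

/-! ### From computations to equivalences -/

/-- The word `left.reverse q head right v` of a configuration. -/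
def Config.toWord (c : Config m n) : List (Letter m n) :=
  c.left.reverse.map sym ++ st c.state :: sym c.head :: c.right.map sym ++ [endMark]

theorem StepNoExt.equivalent {c d : Config m n} (h : T.StepNoExt c d) :
    T.calculus.Equivalent c.toWord d.toWord := by
  cases h with
  | @print q a q' b u w h =>
    simpa [Config.toWord] using AssociativeCalculus.Equivalent.of_rel (C := T.calculus)
      (DefiningRel.print h) (u.reverse.map sym) (w.map sym ++ [endMark])
  | @moveRight q a q' u b w h =>
    simpa [Config.toWord] using AssociativeCalculus.Equivalent.of_rel (C := T.calculus)
      (DefiningRel.right h) (u.reverse.map sym) (sym b :: (w.map sym ++ [endMark]))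
  | @extendRight q a q' u h =>
    have h1 := AssociativeCalculus.Equivalent.of_rel (C := T.calculus)
      (DefiningRel.right h) (u.reverse.map sym) [endMark]
    -- The relation `a_0 v ≡ v`, used backwards, creates the new blank cell under the head.
    have h2 := AssociativeCalculus.Equivalent.of_rel (C := T.calculus)
      DefiningRel.blank (u.reverse.map sym ++ [sym a, st q']) []
    simp only [List.append_assoc, List.append_nil] at h1 h2
    simpa [Config.toWord] using h1.trans h2.symm
  | @moveLeft q a q' c u w h =>
    simpa [Config.toWord] using AssociativeCalculus.Equivalent.of_rel (C := T.calculus)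
      (DefiningRel.left h c) (u.reverse.map sym) (w.map sym ++ [endMark])

theorem equivalent_of_reflTransGen {c d : Config m n}
    (h : Relation.ReflTransGen T.StepNoExt c d) : T.calculus.Equivalent c.toWord d.toWord := by
  induction h with
  | refl => exact .refl _
  | tail _ h ih => exact .trans ih h.equivalent

theorem equivalent_replicate_blank (T : TuringMachine m n) (u : List (Letter m n)) (s : ℕ) :
    T.calculus.Equivalent (u ++ List.replicate s (sym 0) ++ [endMark]) (u ++ [endMark]) := by
  induction s with
  | zero => simpa using .refl _
  | succ s ih =>
    have h := AssociativeCalculus.Equivalent.of_rel (C := T.calculus)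
      DefiningRel.blank (u ++ List.replicate s (sym 0)) []
    refine .trans ?_ ih
    simpa [List.replicate_succ'] using h

theorem equivalent_of_computes {E : ℕ →. ℕ} (hT : T.Computes E) {x y : ℕ} (h : y ∈ E x) :
    T.calculus.Equivalent (word m 1 x) (word m 0 y) := by
  obtain ⟨s, hs⟩ := (hT x).1 y h
  have h1 := equivalent_of_reflTransGen hs
  have h2 := equivalent_replicate_blank T ([st 0, sym 0] ++ List.replicate y (sym 1)) s
  refine .trans ?_ h2
  simpa [Config.toWord, initial, final, word] using h1

/-! ### From equivalences to computations -/

/-- An infinite sequence of tape symbols with a new first term. -/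
def prepend (a : Fin (m + 2)) (r : ℕ → Fin (m + 2)) : ℕ → Fin (m + 2)
  | 0 => a
  | i + 1 => r i

theorem prepend_inj {a b : Fin (m + 2)} {r r' : ℕ → Fin (m + 2)} :
    prepend a r = prepend b r' ↔ a = b ∧ r = r' := by
  refine ⟨fun h => ⟨congrFun h 0, funext fun i => congrFun h (i + 1)⟩, ?_⟩
  rintro ⟨rfl, rfl⟩
  rfl

theorem prepend_blank : prepend (0 : Fin (m + 2)) (fun _ => 0) = fun _ => 0 := by
  funext i
  cases i <;> rfl

/-- Continuation of a finite tape by blanks. -/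
def pad (w : List (Fin (m + 2))) : ℕ → Fin (m + 2) :=
  w.foldr prepend fun _ => 0

theorem pad_replicate_one (y i : ℕ) :
    pad (List.replicate y (1 : Fin (m + 2))) i = if i < y then 1 else 0 := by
  induction y generalizing i with
  | zero => simp [pad]
  | succ y ih =>
    cases i with
    | zero => simp [pad, List.replicate_succ, prepend]
    | succ i => simpa [pad, List.replicate_succ, prepend] using ih i

/-- The blank continuation loses no information about the result: the place where the ones end is
still visible. -/
theorem pad_replicate_one_injective :
    Function.Injective fun y => pad (List.replicate y (1 : Fin (m + 2))) := by
  intro y z h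
  have hy := congrFun h y
  have hz := congrFun h z
  simp only [pad_replicate_one] at hy hz
  by_contra hne
  rcases Nat.lt_or_gt_of_ne hne with h | h <;> simp_all

/-- Values of words, read from right to left: the empty word, an ill-formed word, a right part of
a tape, or a configuration whose tape is unbounded to the right. -/
inductive WordValue (m n : ℕ)
  | empty
  | illFormed
  | tape (r : ℕ → Fin (m + 2))
  | config (l : List (Fin (m + 2))) (q : Fin (n + 2)) (r : ℕ → Fin (m + 2))

/-- The value of a word is determined by its first letter and the value of the remaining word. -/
def WordValue.act : Letter m n → WordValue m n → WordValue m n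
  | .inl a, .tape r => .tape (prepend a r)
  | .inl a, .config l q r => .config (l ++ [a]) q r
  | .inr (.inl q), .tape r => .config [] q r
  | .inr (.inr _), .empty => .tape fun _ => 0
  | _, _ => .illFormed

/-- The value of a word. -/
def wordValue (w : List (Letter m n)) : WordValue m n :=
  w.foldr WordValue.act .empty

/-- One step of the machine, as a relation between the values of words. -/
inductive ValueStep (T : TuringMachine m n) : WordValue m n → WordValue m n → Prop
  | print {q a q' b} (l r) (h : T.program q a = some (q', .write b)) :
      ValueStep T (.config l q (prepend a r)) (.config l q' (prepend b r))
  | right {q a q'} (l r) (h : T.program q a = some (q', .move .right)) :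
      ValueStep T (.config l q (prepend a r)) (.config (a :: l) q' r)
  | left {q a q'} (c l r) (h : T.program q a = some (q', .move .left)) :
      ValueStep T (.config (c :: l) q (prepend a r)) (.config l q' (prepend c (prepend a r)))

/-- The value determines the state and, since `prepend` is injective, the scanned symbol; the
program has at most one instruction for such a pair. -/
theorem ValueStep.deterministic (x y z : WordValue m n) (h : T.ValueStep x y)
    (h' : T.ValueStep x z) : y = z := by
  generalize hx : x = x' at h'
  rcases h with _ | _ | _ <;> rcases h' with _ | _ | _ <;>
    simp only [WordValue.config.injEq, prepend_inj, List.cons.injEq] at hx <;>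
    simp_all

/-- Steps relate configurations only. A tape symbol put in front becomes the farthest cell on the
left, which does not disturb the step; a state letter or `v` in front makes both sides ill-formed.
-/
theorem ValueStep.act {x y : WordValue m n} (h : T.ValueStep x y) (a : Letter m n) :
    Relation.EqvGen T.ValueStep (x.act a) (y.act a) := by
  rcases a with a | _ | _
  · refine .rel _ _ ?_
    cases h with
    | print l r h => exact .print _ _ h
    | right l r h => exact .right _ _ h
    | left c l r h => exact .left _ _ _ h
  · cases h <;> exact .refl _
  · cases h <;> exact .refl _

theorem eqvGen_valueStep_foldr {x y : WordValue m n} (h : Relation.EqvGen T.ValueStep x y)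
    (s : List (Letter m n)) :
    Relation.EqvGen T.ValueStep (s.foldr WordValue.act x) (s.foldr WordValue.act y) := by
  induction s with
  | nil => exact h
  | cons a s ih =>
    simp only [List.foldr_cons]
    generalize s.foldr WordValue.act x = x at ih
    generalize s.foldr WordValue.act y = y at ih
    clear h
    induction ih with
    | rel x y h => exact h.act a
    | refl x => exact .refl _
    | symm x y _ ih => exact .symm _ _ ih
    | trans x y z _ _ ih1 ih2 => exact .trans _ _ _ ih1 ih2

/-- An instruction relation gives a step if what follows it is a right part of a tape, and otherwise
both sides are ill-formed. The relation `a_0 v ≡ v` matters only at the end of a word, where a blank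
in front of infinitely many blanks changes nothing. -/
theorem DefiningRel.eqvGen_valueStep {l r : List (Letter m n)} (h : T.DefiningRel l r)
    (x : WordValue m n) :
    Relation.EqvGen T.ValueStep (l.foldr WordValue.act x) (r.foldr WordValue.act x) := by
  cases h with
  | print h =>
    rcases x with _ | _ | _ | _
    case tape r => exact .rel _ _ (.print [] r h)
    all_goals exact .refl _
  | left h c =>
    rcases x with _ | _ | _ | _
    case tape r => exact .rel _ _ (.left c [] r h)
    all_goals exact .refl _
  | right h =>
    rcases x with _ | _ | _ | _
    case tape r => exact .rel _ _ (.right [] r h)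
    all_goals exact .refl _
  | blank =>
    rcases x with _ | _ | _ | _
    case empty =>
      simp only [List.foldr_cons, List.foldr_nil, sym, endMark, WordValue.act, prepend_blank]
      exact .refl _
    all_goals exact .refl _

theorem eqvGen_wordValue {u w : List (Letter m n)} (h : T.calculus.Equivalent u w) :
    Relation.EqvGen T.ValueStep (wordValue u) (wordValue w) := by
  induction h with
  | rel x y h =>
    obtain ⟨s, t, l, r, hlr⟩ := h
    simp only [wordValue, List.foldr_append]
    exact eqvGen_valueStep_foldr (DefiningRel.eqvGen_valueStep hlr _) s
  | refl x => exact .refl _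
  | symm x y _ ih => exact .symm _ _ ih
  | trans x y z _ _ ih1 ih2 => exact .trans _ _ _ ih1 ih2

/-- The value of the word of a configuration. -/
def Config.toValue (c : Config m n) : WordValue m n :=
  .config c.left c.state (prepend c.head (pad c.right))

theorem wordValue_word (k : Fin (n + 2)) (x : ℕ) :
    wordValue (word m k x) = .config [] k (prepend 0 (pad (List.replicate x 1))) := by
  have h : wordValue (List.replicate x (sym 1) ++ [endMark] : List (Letter m n)) =
      .tape (pad (List.replicate x 1)) := by
    induction x with
    | zero => rfl
    | succ x ih =>
      rw [List.replicate_succ, List.cons_append]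
      change WordValue.act _ (wordValue (List.replicate x (sym 1) ++ [endMark])) = _
      rw [ih]
      rfl
  change WordValue.act (st k) (WordValue.act (sym 0)
    (wordValue (List.replicate x (sym 1) ++ [endMark]))) = _
  rw [h]
  rfl

/-- A left move of values needs a cell to the left, so no extension on that side can occur. A right
move off the finite tape is matched by a step that adds a blank, which the value contained already.
-/
theorem ValueStep.lift {c : Config m n} {y : WordValue m n} (h : T.ValueStep c.toValue y) :
    ∃ d : Config m n, T.StepNoExt c d ∧ d.toValue = y := by
  obtain ⟨u, q, a, w⟩ := c
  generalize hx : Config.toValue ⟨u, q, a, w⟩ = x at h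
  cases h with
  | @print q a q' b l r h =>
    simp only [Config.toValue, WordValue.config.injEq, prepend_inj] at hx
    obtain ⟨rfl, rfl, rfl, rfl⟩ := hx
    exact ⟨_, .print u w h, rfl⟩
  | @right q a q' l r h =>
    simp only [Config.toValue, WordValue.config.injEq, prepend_inj] at hx
    obtain ⟨rfl, rfl, rfl, rfl⟩ := hx
    cases w with
    | nil => exact ⟨_, .extendRight u h, by simp [Config.toValue, pad, prepend_blank]⟩
    | cons b w => exact ⟨_, .moveRight u b w h, rfl⟩
  | @left q a q' b l r h =>
    simp only [Config.toValue, WordValue.config.injEq, prepend_inj] at hx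
    obtain ⟨rfl, rfl, rfl, rfl⟩ := hx
    exact ⟨_, .moveLeft b l w h, rfl⟩

theorem reflTransGen_valueStep_lift {c : Config m n} {y : WordValue m n}
    (h : Relation.ReflTransGen T.ValueStep c.toValue y) :
    ∃ d : Config m n, Relation.ReflTransGen T.StepNoExt c d ∧ d.toValue = y := by
  induction h with
  | refl => exact ⟨c, .refl, rfl⟩
  | tail _ h ih =>
    obtain ⟨d, hd, rfl⟩ := ih
    obtain ⟨e, he, rfl⟩ := h.lift
    exact ⟨e, hd.tail he, rfl⟩

theorem ValueStep.irreducible_final (T : TuringMachine m n) (l r) (y : WordValue m n) :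
    ¬ T.ValueStep (.config l 0 r) y := by
  intro h
  cases h <;> simp_all [T.program_final]

/-- If `E x = y`, the final words for `y` and `i` are equivalent; both values are irreducible, so
they coincide. If `E x` is undefined, lifting the reduction would yield a computation that stops. -/
theorem mem_of_equivalent {E : ℕ →. ℕ} (hT : T.Computes E) {x i : ℕ}
    (h : T.calculus.Equivalent (word m 1 x) (word m 0 i)) : i ∈ E x := by
  by_cases hx : (E x).Dom
  · obtain ⟨y, hy⟩ := Part.dom_iff_mem.1 hx
    have h1 := eqvGen_wordValue
      ((equivalent_of_computes hT hy).symm.trans h)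
    rw [wordValue_word, wordValue_word] at h1
    have h2 := h1.reflTransGen_of_irreducible ValueStep.deterministic
      (ValueStep.irreducible_final T _ _)
    rcases h2.cases_head with h3 | ⟨d, hd, -⟩
    · simp only [WordValue.config.injEq, prepend_inj, true_and] at h3
      exact pad_replicate_one_injective h3 ▸ hy
    · exact (ValueStep.irreducible_final T _ _ _ hd).elim
  · have h1 := eqvGen_wordValue h
    rw [wordValue_word, wordValue_word] at h1
    have h2 := h1.reflTransGen_of_irreducible ValueStep.deterministic
      (ValueStep.irreducible_final T _ _)
    obtain ⟨d, hd, hd'⟩ := reflTransGen_valueStep_lift (c := initial m n x) h2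
    refine ((hT x).2 hx d (Relation.ReflTransGen.mono (fun _ _ => .noExt) _ _ hd) ?_).elim
    simp only [Config.toValue, WordValue.config.injEq] at hd'
    rw [Halted, hd'.2.1, T.program_final]

theorem equivalent_iff_mem {E : ℕ →. ℕ} (hT : T.Computes E) (x i : ℕ) :
    T.calculus.Equivalent (word m 1 x) (word m 0 i) ↔ i ∈ E x :=
  ⟨mem_of_equivalent hT, equivalent_of_computes hT⟩

/-! ### Undecidability -/

theorem computable_word (k : Fin (n + 2)) : Computable (word m k) := by
  have h : Primrec fun x : ℕ => (List.range x).map fun _ => (sym 1 : Letter m n) :=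
    Primrec.list_map Primrec.list_range (Primrec.const _).to₂
  refine (Primrec.list_append.comp (Primrec.list_append.comp (Primrec.const [st k, sym 0]) h)
    (Primrec.const [endMark])).to_comp.of_eq fun x => ?_
  simp [word]

end TuringMachine

namespace IsInextensible

variable {E : ℕ →. ℕ}

/-- Compute `E x` and diverge unless the value is `i`; the domain of this procedure is `M_i`. -/
theorem rePred (hE : IsInextensible E) (i : ℕ) : REPred fun x : ℕ => i ∈ E x := by
  have h : Partrec fun x : ℕ => (E x).bind fun y => 
      ((if y = i then some () else none : Option Unit) : Part Unit) := by
    refine hE.partrec.bind (Computable.ofOption ?_)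
    exact (Primrec.ite (Primrec.eq.comp Primrec.snd (Primrec.const i)) (Primrec.const _)
      (Primrec.const _)).to_comp
  refine h.dom_re.of_eq fun x => ?_
  constructor
  · rw [Part.dom_iff_mem]
    rintro ⟨u, hu⟩
    obtain ⟨y, hy, hyu⟩ := Part.mem_bind_iff.1 hu
    split_ifs at hyu with hyi
    · exact hyi ▸ hy
    · simp at hyu
  · intro hi
    exact Part.dom_iff_mem.2 ⟨(), Part.mem_bind_iff.2 ⟨i, hi, by simp⟩⟩

/-- A decision procedure would give the total extension with value `i` on `M_i` and `1 - i`
elsewhere. -/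
theorem not_computablePred (hE : IsInextensible E) {i : ℕ} (hi : i = 0 ∨ i = 1) :
    ¬ ComputablePred fun x : ℕ => i ∈ E x := by
  intro h
  obtain ⟨f, hf, hfe⟩ := ComputablePred.computable_iff.1 h
  refine hE.no_extension ⟨fun x => cond (f x) i (1 - i),
    Computable.cond hf (Computable.const _) (Computable.const _), fun x y hy => ?_⟩
  have hx : i ∈ E x ↔ f x = true := iff_of_eq (congrFun hfe x)
  beta_reduce
  by_cases hyi : y = i
  · rw [hx.1 (hyi ▸ hy), hyi]
    rfl
  · have : f x = false := by
      rw [← Bool.not_eq_true, ← hx]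
      exact fun h => hyi (Part.mem_unique hy h)
    rw [this]
    have := hE.zero_or_one x y hy
    simp only [cond_false]
    omega

theorem not_wordProblemDecidable (hE : IsInextensible E) {m n : ℕ} {T : TuringMachine m n}
    (hT : T.Computes E) : ¬ T.calculus.WordProblemDecidable := by
  intro h
  refine hE.not_computablePred (.inl rfl) ?_
  obtain ⟨f, hf, hfe⟩ := ComputablePred.computable_iff.1 h
  refine ComputablePred.computable_iff.2
    ⟨fun x => f (TuringMachine.word m 1 x, TuringMachine.word m 0 0),
      hf.comp ((TuringMachine.computable_word 1).pair (Computable.const _)), funext fun x => ?_⟩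
  rw [← TuringMachine.equivalent_iff_mem hT]
  exact congrFun hfe (TuringMachine.word m 1 x, TuringMachine.word m 0 0)

end IsInextensible

/-! ### Renaming the letters of a calculus -/

namespace AssociativeCalculus

variable {α β : Type}

/-- Renaming of the letters of an associative calculus. -/
def rename (C : AssociativeCalculus α) (e : α ≃ β) : AssociativeCalculus β where
  rels := Prod.map (List.map e) (List.map e) '' C.rels
  finite_rels := C.finite_rels.image _
  ne_nil := by
    rintro _ ⟨p, hp, rfl⟩
    simpa using C.ne_nil p hp

theorem Equivalent.rename {C : AssociativeCalculus α} (e : α ≃ β) {u w : List α}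
    (h : C.Equivalent u w) : (C.rename e).Equivalent (u.map e) (w.map e) := by
  induction h with
  | rel x y h =>
    obtain ⟨s, t, l, r, hlr⟩ := h
    simp only [List.map_append]
    exact .of_rel (C := C.rename e) ⟨(l, r), hlr, rfl⟩ _ _
  | refl x => exact .refl _
  | symm x y _ ih => exact .symm ih
  | trans x y z _ _ ih1 ih2 => exact .trans ih1 ih2

theorem rename_symm (C : AssociativeCalculus α) (e : α ≃ β) : (C.rename e).rename e.symm = C := by
  have h : ((C.rename e).rename e.symm).rels = C.rels := by
    have hid : (Prod.map (List.map e.symm) (List.map e.symm)) ∘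
        (Prod.map (List.map e) (List.map e)) = id := by
      ext1 ⟨l, r⟩
      simp
    change _ '' (_ '' C.rels) = C.rels
    rw [← Set.image_comp, hid, Set.image_id]
  cases C
  simpa [AssociativeCalculus.rename] using h

theorem equivalent_rename_iff (C : AssociativeCalculus α) (e : α ≃ β) (u w : List α) :
    (C.rename e).Equivalent (u.map e) (w.map e) ↔ C.Equivalent u w := by
  refine ⟨fun h => ?_, Equivalent.rename e⟩
  have h1 := h.rename e.symm
  rw [rename_symm] at h1
  simpa using h1

theorem WordProblemDecidable.of_rename [Primcodable α] [Primcodable β] [Finite α]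
    {C : AssociativeCalculus α} (e : α ≃ β) (h : (C.rename e).WordProblemDecidable) :
    C.WordProblemDecidable := by
  have hmap : Primrec fun u : List α => u.map e :=
    Primrec.list_map Primrec.id ((Primrec.dom_finite e).comp Primrec.snd).to₂
  obtain ⟨f, hf, hfe⟩ := ComputablePred.computable_iff.1 h
  refine ComputablePred.computable_iff.2 ⟨fun p => f (p.1.map e, p.2.map e),
    hf.comp ((hmap.comp Primrec.fst).pair (hmap.comp Primrec.snd)).to_comp, funext fun p => ?_⟩
  rw [← equivalent_rename_iff C e]
  exact congrFun hfe (p.1.map e, p.2.map e)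

end AssociativeCalculus

/-! ### Register programs -/

/-- Programs for registers that hold natural numbers and are indexed by natural numbers. -/
inductive RegProgram
  /-- do nothing -/
  | nop
  /-- increase register `r` by one -/
  | inc (r : ℕ)
  /-- decrease register `r` by one, if it is not zero -/
  | dec (r : ℕ)
  | seq (p q : RegProgram)
  /-- repeat `p` as long as register `r` is not zero -/
  | loop (r : ℕ) (p : RegProgram)

namespace RegProgram

open Function

/-- `Exec p s t`: started with the register contents `s`, the program `p` terminates with `t`. -/
inductive Exec : RegProgram → (ℕ → ℕ) → (ℕ → ℕ) → Prop
  | nop (s) : Exec nop s s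
  | inc (r s) : Exec (inc r) s (update s r (s r + 1))
  | dec (r s) : Exec (dec r) s (update s r (s r - 1))
  | seq {p q s t u} (h : Exec p s t) (h' : Exec q t u) : Exec (seq p q) s u
  | loop_zero {r p s} (h : s r = 0) : Exec (loop r p) s s
  | loop_step {r p s t u} (h : s r ≠ 0) (h' : Exec p s t) (h'' : Exec (loop r p) t u) :
      Exec (loop r p) s u

theorem Exec.of_eq {p : RegProgram} {s t t' : ℕ → ℕ} (h : Exec p s t) (ht : t = t') :
    Exec p s t' :=
  ht ▸ h

/-- Set register `r` to zero. -/
def clear (r : ℕ) : RegProgram := loop r (dec r)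

theorem exec_clear (r : ℕ) (s : ℕ → ℕ) : Exec (clear r) s (update s r 0) := by
  generalize hk : s r = k
  induction k generalizing s with
  | zero => exact (Exec.loop_zero hk).of_eq (by rw [← hk, update_eq_self])
  | succ k ih =>
    refine (Exec.loop_step (by omega) (.dec r s) (ih _ (by simp [hk]))).of_eq ?_
    simp

/-- Add register `a` to register `b` and set `a` to zero. -/
def move (a b : ℕ) : RegProgram := loop a (seq (dec a) (inc b))

theorem exec_move {a b : ℕ} (hab : a ≠ b) (s : ℕ → ℕ) :
    Exec (move a b) s (update (update s b (s b + s a)) a 0) := by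
  generalize hk : s a = k
  induction k generalizing s with
  | zero => exact (Exec.loop_zero hk).of_eq (by funext r; simp only [update_apply]; grind)
  | succ k ih =>
    refine (Exec.loop_step (by omega) (.seq (.dec a s) (.inc b _)) (ih _ ?_)).of_eq ?_
    · simp [hab, hk]
    · funext r
      simp only [update_apply]
      grind

/-- Add register `a` to the registers `b` and `c` and set `a` to zero. -/
def moveTwo (a b c : ℕ) : RegProgram := loop a (seq (dec a) (seq (inc b) (inc c)))

theorem exec_moveTwo {a b c : ℕ} (hab : a ≠ b) (hac : a ≠ c) (hbc : b ≠ c) (s : ℕ → ℕ) :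
    Exec (moveTwo a b c) s (update (update (update s b (s b + s a)) c (s c + s a)) a 0) := by
  generalize hk : s a = k
  induction k generalizing s with
  | zero => exact (Exec.loop_zero hk).of_eq (by funext r; simp only [update_apply]; grind)
  | succ k ih =>
    refine (Exec.loop_step (by omega) (.seq (.dec a s) (.seq (.inc b _) (.inc c _)))
      (ih _ ?_)).of_eq ?_
    · simp [hab, hac, hk]
    · funext r
      simp only [update_apply]
      grind

/-- Add register `a` to register `b`, using the auxiliary register `c`. -/
def copy (a b c : ℕ) : RegProgram := seq (moveTwo a b c) (move c a)

theorem exec_copy {a b c : ℕ} (hab : a ≠ b) (hac : a ≠ c) (hbc : b ≠ c) {s : ℕ → ℕ}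
    (hc : s c = 0) : Exec (copy a b c) s (update s b (s b + s a)) := by
  refine (Exec.seq (exec_moveTwo hab hac hbc s) (exec_move hac.symm _)).of_eq ?_
  funext r
  simp only [update_apply]
  grind

/-- Sequential composition of `p 0, …, p (k - 1)`. -/
def iter (p : ℕ → RegProgram) : ℕ → RegProgram
  | 0 => nop
  | k + 1 => seq (iter p k) (p k)

theorem exec_iter {p : ℕ → RegProgram} {s : ℕ → ℕ → ℕ} {k : ℕ}
    (h : ∀ j < k, Exec (p j) (s j) (s (j + 1))) : Exec (iter p k) (s 0) (s k) := by
  induction k with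
  | zero => exact .nop _
  | succ k ih => exact .seq (ih fun j hj => h j (by omega)) (h k (by omega))

/-- The program `p` computes `f` from the registers `ins` into the register `out`, which holds zero
before. It may use the registers from `base` on, which hold zero before and afterwards. -/
def ComputesInto (p : RegProgram) {n : ℕ} (f : List.Vector ℕ n → ℕ) (ins : Fin n → ℕ)
    (out base : ℕ) : Prop :=
  ∀ s : ℕ → ℕ, (∀ r, base ≤ r → s r = 0) → s out = 0 →
    Exec p s (update s out (f (List.Vector.ofFn fun i => s (ins i))))

/-- The inner values are stored in the `n` registers from `base` on, the workspace is moved up to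
`base + n`, and the stored values are cleared at the end. -/
theorem exists_computesInto_comp {m n : ℕ} {f : List.Vector ℕ n → ℕ}
    {g : Fin n → List.Vector ℕ m → ℕ}
    (hf : ∀ (ins : Fin n → ℕ) (out base : ℕ), (∀ i, ins i < base) → out < base →
      (∀ i, ins i ≠ out) → ∃ p, ComputesInto p f ins out base)
    (hg : ∀ j, ∀ (ins : Fin m → ℕ) (out base : ℕ), (∀ i, ins i < base) → out < base →
      (∀ i, ins i ≠ out) → ∃ p, ComputesInto p (g j) ins out base)
    (ins : Fin m → ℕ) (out base : ℕ) (hins : ∀ i, ins i < base) (hout : out < base) :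
    ∃ p, ComputesInto p (fun a => f (List.Vector.ofFn fun i => g i a)) ins out base := by
  obtain ⟨pf, hpf⟩ := hf (fun i => base + i) out (base + n) (fun i => by omega) (by omega)
    (fun i => by omega)
  -- `iter` takes programs indexed by all of `ℕ`; beyond `n` any program will do.
  have hg' : ∀ j : ℕ, ∃ p, ∀ hj : j < n, ComputesInto p (g ⟨j, hj⟩) ins (base + j) (base + n) := by
    intro j
    by_cases hj : j < n
    · obtain ⟨p, hp⟩ := hg ⟨j, hj⟩ ins (base + j) (base + n)
        (fun i => (hins i).trans_le (by omega)) (by omega) (fun i => by have := hins i; omega)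
      exact ⟨p, fun _ => hp⟩
    · exact ⟨nop, fun h => (hj h).elim⟩
  choose pg hpg using hg'
  refine ⟨seq (iter pg n) (seq pf (iter (fun j => clear (base + j)) n)), fun s hs hso => ?_⟩
  let G : ℕ → ℕ := fun j => if h : j < n then g ⟨j, h⟩ (List.Vector.ofFn fun i => s (ins i)) else 0
  -- Register contents after the first `j` inner values have been computed.
  let t : ℕ → ℕ → ℕ := fun j r => if base ≤ r ∧ r < base + j then G (r - base) else s r
  have ht : Exec (iter pg n) (t 0) (t n) := by
    refine exec_iter fun j hj => (hpg j hj (t j) ?_ ?_).of_eq ?_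
    · intro r hr
      have : ¬ (base ≤ r ∧ r < base + j) := by omega
      simp only [t, this, if_false]
      exact hs r (by omega)
    · simp only [t, lt_irrefl, and_false, if_false]
      exact hs _ (by omega)
    · have h1 : (fun i => t j (ins i)) = fun i => s (ins i) := by
        funext i
        have := hins i
        exact if_neg (by omega)
      rw [h1]
      funext r
      by_cases hr : r = base + j
      · subst hr
        simp [t, G, hj]
      · rw [update_of_ne hr]
        have : (base ≤ r ∧ r < base + (j + 1)) ↔ (base ≤ r ∧ r < base + j) := by omega
        simp only [t, this]
  have ht0 : t 0 = s := by
    funext r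
    exact if_neg (by omega)
  rw [ht0] at ht
  set y := f (List.Vector.ofFn fun i => g i (List.Vector.ofFn fun i => s (ins i))) with hy
  have hf' : Exec pf (t n) (update (t n) out y) := by
    refine (hpf (t n) ?_ ?_).of_eq ?_
    · intro r hr
      exact (if_neg (by omega)).trans (hs r (by omega))
    · exact (if_neg (by omega)).trans hso
    · have h1 : (fun i : Fin n => t n (base + i)) =
          fun i => g i (List.Vector.ofFn fun i => s (ins i)) := by
        funext i
        simp [t, G]
      rw [h1]
  let u : ℕ → ℕ → ℕ := fun j r =>
    if base ≤ r ∧ r < base + j then 0 else update (t n) out y r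
  have hu : Exec (iter (fun j => clear (base + j)) n) (u 0) (u n) := by
    refine exec_iter fun j hj => (exec_clear _ _).of_eq ?_
    funext r
    simp only [u, update_apply]
    grind
  have hu0 : u 0 = update (t n) out y := by
    funext r
    exact if_neg (by omega)
  rw [hu0] at hu
  refine (Exec.seq ht (.seq hf' hu)).of_eq ?_
  funext r
  have := hs r
  simp only [u, t, update_apply]
  grind

/-- Four registers run the recursion: `base` holds the current value, `base + 1` the counter, `base
+ 2` the number of rounds left, and `base + 3` receives the next value before it replaces the
current one. -/
theorem exists_computesInto_prec {n : ℕ} {f : List.Vector ℕ n → ℕ}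
    {g : List.Vector ℕ (n + 2) → ℕ}
    (hf : ∀ (ins : Fin n → ℕ) (out base : ℕ), (∀ i, ins i < base) → out < base →
      (∀ i, ins i ≠ out) → ∃ p, ComputesInto p f ins out base)
    (hg : ∀ (ins : Fin (n + 2) → ℕ) (out base : ℕ), (∀ i, ins i < base) → out < base →
      (∀ i, ins i ≠ out) → ∃ p, ComputesInto p g ins out base)
    (ins : Fin (n + 1) → ℕ) (out base : ℕ) (hins : ∀ i, ins i < base) (hout : out < base) :
    ∃ p, ComputesInto p (fun v : List.Vector ℕ (n + 1) =>
      v.head.rec (f v.tail) fun y IH => g (y ::ᵥ IH ::ᵥ v.tail)) ins out base := by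
  obtain ⟨pf, hpf⟩ := hf (fun i => ins i.succ) base (base + 4)
    (fun i => (hins _).trans_le (by omega)) (by omega) (fun i => (hins _).ne)
  obtain ⟨pg, hpg⟩ := hg (Fin.cons (base + 1) (Fin.cons base fun i => ins i.succ)) (base + 3)
    (base + 4)
    (by
      refine Fin.cases ?_ (Fin.cases ?_ fun i => ?_)
      · simp
      · simp
      · simpa using (hins i.succ).trans_le (by omega))
    (by omega)
    (by
      refine Fin.cases ?_ (Fin.cases ?_ fun i => ?_)
      · simp
      · simp
      · have := hins i.succ
        simp only [Fin.cons_succ]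
        omega)
  let body := seq (dec (base + 2)) (seq pg (seq (clear base) (seq (move (base + 3) base)
    (inc (base + 1)))))
  refine ⟨seq (copy (ins 0) (base + 2) (base + 3)) (seq pf (seq (loop (base + 2) body)
    (seq (move base out) (clear (base + 1))))), fun s hs hso => ?_⟩
  have hin0 := hins 0
  have h0 := hs base (by omega)
  have h1 := hs (base + 1) (by omega)
  have h2 := hs (base + 2) (by omega)
  have h3 := hs (base + 3) (by omega)
  set v : List.Vector ℕ n := List.Vector.ofFn fun i => s (ins i.succ) with hv
  let R : ℕ → ℕ := fun k => Nat.rec (f v) (fun y IH => g (y ::ᵥ IH ::ᵥ v)) k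
  -- Register contents after `k` rounds, with `d` rounds left.
  let t : ℕ → ℕ → ℕ → ℕ := fun k d =>
    update (update (update s base (R k)) (base + 1) k) (base + 2) d
  have hbody : ∀ k d, Exec body (t k (d + 1)) (t (k + 1) d) := by
    intro k d
    have hd : Exec (dec (base + 2)) (t k (d + 1)) (t k d) :=
      (Exec.dec _ _).of_eq (by simp [t])
    have hpg' : Exec pg (t k d) (update (t k d) (base + 3) (R (k + 1))) := by
      refine (hpg (t k d) ?_ ?_).of_eq ?_
      · intro r hr
        have := hs r (by omega)
        simp only [t, update_apply]
        grind
      · simp [t, h3]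
      · have h4 : (List.Vector.ofFn fun i => t k d ((Fin.cons (base + 1) (Fin.cons base
            fun i => ins i.succ) : Fin (n + 2) → ℕ) i)) = k ::ᵥ R k ::ᵥ v := by
          simp only [List.Vector.ofFn, Fin.cons_zero, Fin.cons_succ]
          congr 1
          · simp [t]
          · congr 1
            · simp [t]
            · rw [hv]
              congr 1
              funext i
              have := hins i.succ
              simp only [t, update_apply]
              grind
        rw [h4]
    refine (Exec.seq hd (.seq hpg' (.seq (exec_clear _ _) (.seq (exec_move (by omega) _)
      (.inc _ _))))).of_eq ?_
    funext r
    simp only [t, update_apply]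
    grind
  have hloop : ∀ d k, Exec (loop (base + 2) body) (t k d) (t (k + d) 0) := by
    intro d
    induction d with
    | zero => exact fun k => .loop_zero (by simp [t])
    | succ d ih =>
      intro k
      refine (Exec.loop_step (by simp [t]) (hbody k d) (ih (k + 1))).of_eq ?_
      congr 1
      omega
  have hcopy := exec_copy (a := ins 0) (b := base + 2) (c := base + 3) (by omega) (by omega)
    (by omega) h3
  have hf' : Exec pf (update s (base + 2) (s (ins 0))) (t 0 (s (ins 0))) := by
    refine (hpf _ ?_ ?_).of_eq ?_
    · intro r hr
      rw [update_of_ne (by omega)]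
      exact hs r (by omega)
    · simpa using h0
    · have h4 : (fun i : Fin n => update s (base + 2) (s (ins 0)) (ins i.succ)) =
          fun i => s (ins i.succ) := by
        funext i
        have := hins i.succ
        rw [update_of_ne (by omega)]
      have hR0 : f v = R 0 := rfl
      rw [h4, ← hv, hR0]
      clear_value R
      funext r
      simp only [t, update_apply]
      grind
  rw [h2, zero_add] at hcopy
  refine (Exec.seq hcopy (.seq hf' (.seq (hloop _ _) (.seq (exec_move (by omega) _)
    (exec_clear _ _))))).of_eq ?_
  have hR : (List.Vector.ofFn fun i => s (ins i)).head.rec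
      (f (List.Vector.ofFn fun i => s (ins i)).tail)
      (fun y IH => g (y ::ᵥ IH ::ᵥ (List.Vector.ofFn fun i => s (ins i)).tail)) =
      R (s (ins 0)) := rfl
  beta_reduce
  -- From here on only the value of the recursion matters, so `R` can be made opaque.
  rw [hR, zero_add]
  clear_value R
  funext r
  simp only [t, update_apply]
  grind

/-- Every primitive recursive function is computed by a register program. -/
theorem exists_computesInto {n : ℕ} {f : List.Vector ℕ n → ℕ} (hf : Nat.Primrec' f) :
    ∀ (ins : Fin n → ℕ) (out base : ℕ), (∀ i, ins i < base) → out < base →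
      (∀ i, ins i ≠ out) → ∃ p, ComputesInto p f ins out base := by
  induction hf with
  | zero =>
    exact fun ins out base _ _ _ => ⟨nop, fun s _ hso => (Exec.nop s).of_eq (by simp [← hso])⟩
  | succ =>
    intro ins out base hins hout hne
    have := hins 0
    refine ⟨seq (copy (ins 0) out base) (inc out), fun s hs hso => (Exec.seq (exec_copy (hne 0)
      (by omega) (by omega) (hs base le_rfl)) (.inc _ _)).of_eq ?_⟩
    simp [hso, List.Vector.ofFn]
  | get i =>
    intro ins out base hins hout hne
    have := hins i
    refine ⟨copy (ins i) out base, fun s hs hso => (exec_copy (hne i)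
      (by omega) (by omega) (hs base le_rfl)).of_eq ?_⟩
    simp [hso]
  | comp g _ _ ihf ihg =>
    exact fun ins out base hins hout _ => exists_computesInto_comp ihf ihg ins out base hins hout
  | prec _ _ ihf ihg =>
    exact fun ins out base hins hout _ => exists_computesInto_prec ihf ihg ins out base hins hout

end RegProgram

/-! ### Register machines -/

/-- Instructions of a register machine. -/
inductive RegInstr
  /-- increase register `r` by one and pass to the next instruction -/
  | inc (r : ℕ)
  /-- decrease register `r` by one, if it is not zero, and pass to the next instruction -/
  | dec (r : ℕ)
  /-- go to `l₀` if register `r` is zero and to `l₁` otherwise -/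
  | test (r l₀ l₁ : ℕ)

namespace RegInstr

open Function

/-- The register of an instruction. -/
def reg : RegInstr → ℕ
  | inc r => r
  | dec r => r
  | test r _ _ => r

/-- One step of the register machine with the given list of instructions. -/
inductive Step (code : List RegInstr) : ℕ × (ℕ → ℕ) → ℕ × (ℕ → ℕ) → Prop
  | inc {pc r} (s) (h : code[pc]? = some (inc r)) :
      Step code (pc, s) (pc + 1, update s r (s r + 1))
  | dec {pc r} (s) (h : code[pc]? = some (dec r)) :
      Step code (pc, s) (pc + 1, update s r (s r - 1))
  | test_zero {pc r l₀ l₁} (s : ℕ → ℕ) (h : code[pc]? = some (test r l₀ l₁))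
      (hl : l₀ ≤ code.length) (hs : s r = 0) : Step code (pc, s) (l₀, s)
  | test_ne_zero {pc r l₀ l₁} (s : ℕ → ℕ) (h : code[pc]? = some (test r l₀ l₁))
      (hl : l₁ ≤ code.length) (hs : s r ≠ 0) : Step code (pc, s) (l₁, s)

end RegInstr

namespace RegProgram

open Relation

/-- The number of instructions of a compiled program. -/
def size : RegProgram → ℕ
  | nop => 0
  | inc _ => 1
  | dec _ => 1
  | seq p q => p.size + q.size
  | loop _ p => p.size + 2

/-- Compilation of a program whose first instruction has the address `o`. -/
def compile : RegProgram → ℕ → List RegInstr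
  | nop, _ => []
  | inc r, _ => [.inc r]
  | dec r, _ => [.dec r]
  | seq p q, o => p.compile o ++ q.compile (o + p.size)
  | loop r p, o => .test r (o + (p.size + 2)) (o + 1) :: (p.compile (o + 1) ++ [.test r o o])

theorem length_compile (p : RegProgram) (o : ℕ) : (p.compile o).length = p.size := by
  induction p generalizing o with
  | nop | inc | dec => rfl
  | seq p q ihp ihq => simp [compile, size, ihp, ihq]
  | loop r p ih => simp [compile, size, ih]

/-- The instructions of `code` from the address `o` on begin with those of `p`. -/
def IsPartOf (p : RegProgram) (code : List RegInstr) (o : ℕ) : Prop :=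
  ∃ pre post, code = pre ++ p.compile o ++ post ∧ pre.length = o

theorem IsPartOf.left {p q : RegProgram} {code : List RegInstr} {o : ℕ}
    (h : (seq p q).IsPartOf code o) : p.IsPartOf code o := by
  obtain ⟨pre, post, rfl, rfl⟩ := h
  exact ⟨pre, q.compile (pre.length + p.size) ++ post, by simp [compile], rfl⟩

theorem IsPartOf.right {p q : RegProgram} {code : List RegInstr} {o : ℕ}
    (h : (seq p q).IsPartOf code o) : q.IsPartOf code (o + p.size) := by
  obtain ⟨pre, post, rfl, rfl⟩ := h
  exact ⟨pre ++ p.compile pre.length, post, by simp [compile], by simp [length_compile]⟩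

theorem IsPartOf.body {r : ℕ} {p : RegProgram} {code : List RegInstr} {o : ℕ}
    (h : (loop r p).IsPartOf code o) : p.IsPartOf code (o + 1) := by
  obtain ⟨pre, post, rfl, rfl⟩ := h
  exact ⟨pre ++ [.test r (pre.length + (p.size + 2)) (pre.length + 1)],
    .test r pre.length pre.length :: post, by simp [compile], by simp⟩

theorem IsPartOf.add_size_le {p : RegProgram} {code : List RegInstr} {o : ℕ}
    (h : p.IsPartOf code o) : o + p.size ≤ code.length := by
  obtain ⟨pre, post, rfl, rfl⟩ := h
  simp [length_compile]

theorem IsPartOf.getElem? {p : RegProgram} {code : List RegInstr} {o : ℕ}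
    (h : p.IsPartOf code o) {i : ℕ} (hi : i < p.size) : code[o + i]? = (p.compile o)[i]? := by
  obtain ⟨pre, post, rfl, rfl⟩ := h
  rw [List.append_assoc, List.getElem?_append_right (by omega), Nat.add_sub_cancel_left,
    List.getElem?_append_left (by rwa [length_compile])]

theorem IsPartOf.loop_enter {r : ℕ} {p : RegProgram} {code : List RegInstr} {o : ℕ}
    (h : (loop r p).IsPartOf code o) {s : ℕ → ℕ} (hs : s r ≠ 0) :
    RegInstr.Step code (o, s) (o + 1, s) := by
  have h1 := h.getElem? (i := 0) (by simp [size])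
  have h2 := h.add_size_le
  simp only [size] at h2
  exact .test_ne_zero s (by simpa [compile] using h1) (by omega) hs

theorem IsPartOf.loop_exit {r : ℕ} {p : RegProgram} {code : List RegInstr} {o : ℕ}
    (h : (loop r p).IsPartOf code o) {s : ℕ → ℕ} (hs : s r = 0) :
    RegInstr.Step code (o, s) (o + (loop r p).size, s) := by
  have h1 := h.getElem? (i := 0) (by simp [size])
  exact .test_zero s (by simpa [compile, size] using h1) h.add_size_le hs

/-- The last instruction of a compiled loop is a test with equal targets, hence an unconditional
jump. -/
theorem IsPartOf.loop_back {r : ℕ} {p : RegProgram} {code : List RegInstr} {o : ℕ}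
    (h : (loop r p).IsPartOf code o) (s : ℕ → ℕ) :
    RegInstr.Step code (o + 1 + p.size, s) (o, s) := by
  have h1 := h.getElem? (i := p.size + 1) (by simp [size])
  have h2 := h.add_size_le
  have h3 : code[o + 1 + p.size]? = some (.test r o o) := by
    rw [add_assoc, add_comm 1, h1]
    simp [compile, length_compile]
  by_cases hs : s r = 0
  · exact .test_zero s h3 (by omega) hs
  · exact .test_ne_zero s h3 (by omega) hs

theorem Exec.reflTransGen {p : RegProgram} {s t : ℕ → ℕ} (h : Exec p s t)
    {code : List RegInstr} {o : ℕ} (hp : p.IsPartOf code o) :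
    ReflTransGen (RegInstr.Step code) (o, s) (o + p.size, t) := by
  induction h generalizing o with
  | nop s => exact .refl
  | inc r s =>
    have h := hp.getElem? (i := 0) (by simp [size])
    exact .single (.inc s (by simpa [compile] using h))
  | dec r s =>
    have h := hp.getElem? (i := 0) (by simp [size])
    exact .single (.dec s (by simpa [compile] using h))
  | @seq p q s t u _ _ ihp ihq =>
    have h := (ihp hp.left).trans (ihq hp.right)
    rwa [add_assoc] at h
  | loop_zero hs => exact .single (hp.loop_exit hs)
  | loop_step hs _ _ ihp ih =>
    exact .head (hp.loop_enter hs) ((ihp hp.body).trans (.head (hp.loop_back _) (ih hp)))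

/-- One execution of the body of a loop. -/
theorem IsPartOf.loop_transGen {r : ℕ} {p : RegProgram} {code : List RegInstr} {o : ℕ}
    (h : (loop r p).IsPartOf code o) {s t : ℕ → ℕ} (hs : s r ≠ 0) (hst : Exec p s t) :
    TransGen (RegInstr.Step code) (o, s) (o, t) :=
  .head' (h.loop_enter hs) ((hst.reflTransGen h.body).tail (h.loop_back t))

end RegProgram

/-! ### Turing machines on a tape that is unbounded to the right -/

namespace TuringMachine

open Relation Function

variable {m n : ℕ} {T : TuringMachine m n}

/-- A machine never stops if each of its configurations with a certain property leads, in at least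
one step, to a configuration with this property. -/
theorem not_halted_of_forall_transGen {P : Config m n → Prop}
    (hP : ∀ c, P c → ∃ d, TransGen T.Step c d ∧ P d) {c d : Config m n} (hc : P c)
    (h : ReflTransGen T.Step c d) : ¬ T.Halted d := by
  have key : ∃ e, TransGen T.Step d e ∧ P e := by
    induction h with
    | refl => exact hP _ hc
    | tail _ h ih =>
      obtain ⟨e, he, hPe⟩ := ih
      obtain ⟨b', hb', hbe⟩ := TransGen.head'_iff.1 he
      -- By determinism the step taken is the first one of the promised run. That run may end here,
      -- so the run from its endpoint is appended to keep at least one step ahead.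
      obtain rfl := h.deterministic hb'
      obtain ⟨e', he', hPe'⟩ := hP e hPe
      exact ⟨e', he'.trans_right hbe, hPe'⟩
  obtain ⟨e, he, -⟩ := key
  obtain ⟨b, hb, -⟩ := TransGen.head'_iff.1 he
  exact hb.not_halted

/-- The configuration `c` has the tape `f 0, f 1, …` (with blanks from some place on), the state `q`
and the head at the place `i`. -/
def HasTape (f : ℕ → Fin (m + 2)) (q : Fin (n + 2)) (i : ℕ) (c : Config m n) : Prop :=
  ∃ k, (∀ j, i + k < j → f j = 0) ∧
    c = ⟨(List.range i).reverse.map f, q, f i, (List.range' (i + 1) k).map f⟩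

/-- From every configuration described by the first three arguments, the machine passes in at
least one step to a configuration described by the last three ones. -/
def Leads (T : TuringMachine m n) (f : ℕ → Fin (m + 2)) (q : Fin (n + 2)) (i : ℕ)
    (f' : ℕ → Fin (m + 2)) (q' : Fin (n + 2)) (i' : ℕ) : Prop :=
  ∀ c, HasTape f q i c → ∃ d, TransGen T.StepNoExt c d ∧ HasTape f' q' i' d

theorem Leads.trans {f f' f'' : ℕ → Fin (m + 2)} {q q' q'' : Fin (n + 2)} {i i' i'' : ℕ}
    (h : T.Leads f q i f' q' i') (h' : T.Leads f' q' i' f'' q'' i'') :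
    T.Leads f q i f'' q'' i'' := by
  intro c hc
  obtain ⟨d, hcd, hd⟩ := h c hc
  obtain ⟨e, hde, he⟩ := h' d hd
  exact ⟨e, hcd.trans hde, he⟩

theorem leads_write {f : ℕ → Fin (m + 2)} {q q' : Fin (n + 2)} {i : ℕ} {b : Fin (m + 2)}
    (h : T.program q (f i) = some (q', .write b)) : T.Leads f q i (update f i b) q' i := by
  rintro c ⟨k, hk, rfl⟩
  refine ⟨_, .single (.print _ _ h), k, fun j hj => ?_, ?_⟩
  · rw [update_of_ne (by omega), hk j hj]
  · congr 1
    · refine List.map_congr_left fun j hj => ?_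
      simp only [List.mem_reverse, List.mem_range] at hj
      rw [update_of_ne (by omega)]
    · simp
    · refine List.map_congr_left fun j hj => ?_
      simp only [List.mem_range'_1] at hj
      rw [update_of_ne (by omega)]

theorem leads_right {f : ℕ → Fin (m + 2)} {q q' : Fin (n + 2)} {i : ℕ}
    (h : T.program q (f i) = some (q', .move .right)) : T.Leads f q i f q' (i + 1) := by
  rintro c ⟨k, hk, rfl⟩
  cases k with
  | zero =>
    refine ⟨_, .single (.extendRight _ h), 0, fun j hj => hk j (by omega), ?_⟩
    simp [List.range_succ, hk (i + 1) (by omega)]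
  | succ k =>
    refine ⟨_, .single (.moveRight _ _ _ h), k, fun j hj => hk j (by omega), ?_⟩
    simp [List.range_succ]

theorem leads_left {f : ℕ → Fin (m + 2)} {q q' : Fin (n + 2)} {i : ℕ}
    (h : T.program q (f (i + 1)) = some (q', .move .left)) : T.Leads f q (i + 1) f q' i := by
  rintro c ⟨k, hk, rfl⟩
  refine ⟨⟨(List.range i).reverse.map f, q', f i, f (i + 1) :: (List.range' (i + 2) k).map f⟩,
    .single ?_, k + 1, fun j hj => hk j (by omega), ?_⟩
  · simpa [List.range_succ] using StepNoExt.moveLeft (f i) ((List.range i).reverse.map f)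
      ((List.range' (i + 2) k).map f) h
  · simp [List.range'_succ]

/-! ### Machines with arbitrary alphabets and sets of states -/

/-- An enumeration of a finite type that begins with two given elements. -/
theorem exists_equiv_fin {α : Type*} [Finite α] {a b : α} (hab : a ≠ b) :
    ∃ (k : ℕ) (e : α ≃ Fin (k + 2)), e a = 0 ∧ e b = 1 := by
  obtain ⟨k, ⟨e⟩⟩ := Finite.exists_equiv_fin α
  have hk : 2 ≤ k := by
    by_contra hk
    have : Subsingleton (Fin k) := Fin.subsingleton_iff_le_one.2 (by omega)
    exact hab (e.injective (Subsingleton.elim _ _))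
  obtain ⟨k, rfl⟩ := Nat.exists_eq_add_of_le' hk
  let e' := e.trans (Equiv.swap (e a) 0)
  have ha : e' a = 0 := by simp [e']
  have hb : e' b ≠ 0 := fun h => hab (e'.injective (ha.trans h.symm))
  refine ⟨k, e'.trans (Equiv.swap (e' b) 1), ?_, by simp⟩
  rw [Equiv.trans_apply, ha]
  exact Equiv.swap_apply_of_ne_of_ne hb.symm (by simp)

variable {Γ Λ : Type}

/-- Renaming of the symbol in a statement. -/
def mapStmt (e : Γ → Fin (m + 2)) : Turing.TM0.Stmt Γ → Turing.TM0.Stmt (Fin (m + 2))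
  | .move d => .move d
  | .write a => .write (e a)

/-- The Turing machine with given alphabet, set of states and program. -/
def ofProgram (e : Γ ≃ Fin (m + 2)) (e' : Λ ≃ Fin (n + 2))
    (P : Λ → Γ → Option (Λ × Turing.TM0.Stmt Γ)) (hP : ∀ a, P (e'.symm 0) a = none) :
    TuringMachine m n where
  program q a := (P (e'.symm q) (e.symm a)).map (Prod.map e' (mapStmt e))
  program_final a := by rw [hP, Option.map_none]

theorem program_ofProgram {e : Γ ≃ Fin (m + 2)} {e' : Λ ≃ Fin (n + 2)}
    {P : Λ → Γ → Option (Λ × Turing.TM0.Stmt Γ)} (hP : ∀ a, P (e'.symm 0) a = none)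
    {q q' : Λ} {a : Γ} {s : Turing.TM0.Stmt Γ} (h : P q a = some (q', s)) :
    (ofProgram e e' P hP).program (e' q) (e a) = some (e' q', mapStmt e s) := by
  simp [ofProgram, h]

end TuringMachine

/-! ### Simulation of register machines by Turing machines -/

namespace RegInstr

open Relation Function TuringMachine

/-- The phases of the execution of one instruction: the head is at the beginning of the tape, it
looks for the end of a register, it is at the last cell of a register, it returns to the beginning
of the tape. -/
inductive Phase
  | home
  | seek
  | erase
  | back

instance : Finite Phase :=
  Finite.of_surjective (fun i : Fin 4 => match i with
    | 0 => Phase.home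
    | 1 => Phase.seek
    | 2 => Phase.erase
    | 3 => Phase.back) (by
      intro p
      cases p
      exacts [⟨0, rfl⟩, ⟨1, rfl⟩, ⟨2, rfl⟩, ⟨3, rfl⟩])

/-- The tape symbols: `none` marks the beginning of the tape, and `some a` is a cell with `k`
tracks, where track `r` is marked if `a r` holds. -/
abbrev TrackSymbol (k : ℕ) : Type := Option (Fin k → Bool)

/-- The states of the simulating machine: `none` is the final state, `some none` the initial
state, and `some (some (pc, p))` belongs to the instruction with address `pc`. -/
abbrev ControlState (l : ℕ) : Type := Option (Option (Fin (l + 1) × Phase))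

/-- The state for the instruction with address `pc ≤ l`. -/
def control (l pc : ℕ) (p : Phase) : ControlState l := some (some (Fin.ofNat (l + 1) pc, p))

variable {k : ℕ}

/-- Is track `r` marked? -/
def isMarked (a : TrackSymbol k) (r : ℕ) : Bool :=
  a.any fun b => if h : r < k then b ⟨r, h⟩ else false

/-- Mark or unmark track `r`. -/
def setMark (a : TrackSymbol k) (r : ℕ) (x : Bool) : TrackSymbol k :=
  a.map fun b i => if i = r then x else b i

/-- The symbol without marks. -/
def blankSymbol (k : ℕ) : TrackSymbol k := some fun _ => false

/-- The symbol that is marked in track `0` only. -/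
def oneSymbol (k : ℕ) : TrackSymbol k := some fun i => decide (i.val = 0)

/-- The program of the simulating machine. -/
def simulator (k : ℕ) (code : List RegInstr) : ControlState code.length → TrackSymbol k →
    Option (ControlState code.length × Turing.TM0.Stmt (TrackSymbol k))
  | none, _ => none
  | some none, _ => some (control _ 0 .home, .write none)
  | some (some (pc, .home)), _ =>
    match code[pc.val]? with
    | none => some (none, .write (blankSymbol k))
    | some _ => some (control _ pc .seek, .move .right)
  | some (some (pc, .seek)), a =>
    match code[pc.val]? with
    | none => none
    | some (.inc r) =>
      if isMarked a r then some (control _ pc .seek, .move .right)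
      else some (control _ pc .back, .write (setMark a r true))
    | some (.dec r) =>
      if isMarked a r then some (control _ pc .seek, .move .right)
      else some (control _ pc .erase, .move .left)
    | some (.test r l₀ l₁) =>
      if isMarked a r then some (control _ l₁ .home, .move .left)
      else some (control _ l₀ .home, .move .left)
  | some (some (pc, .erase)), a =>
    match code[pc.val]?, a with
    | some (.dec r), some b => some (control _ pc .back, .write (setMark (some b) r false))
    -- The head has stepped back onto the mark of the beginning: the register is zero and stays so.
    | _, none => some (control _ (pc + 1) .home, .write none)
    | _, _ => none
  | some (some (pc, .back)), a =>
    match a with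
    | none => some (control _ (pc + 1) .home, .write none)
    | some _ => some (control _ pc .back, .move .left)

/-- The tape that represents the register contents `s`: the first `s r` cells after the mark of
the beginning are marked in track `r`. -/
def tape (k : ℕ) (s : ℕ → ℕ) : ℕ → TrackSymbol k
  | 0 => none
  | j + 1 => some fun r => decide (j < s r)

theorem isMarked_tape {r : ℕ} (hr : r < k) (s : ℕ → ℕ) (j : ℕ) :
    isMarked (tape k s (j + 1)) r = decide (j < s r) := by
  simp [isMarked, tape, hr]

theorem update_tape_inc (k : ℕ) (s : ℕ → ℕ) (r : ℕ) :
    update (tape k s) (s r + 1) (setMark (tape k s (s r + 1)) r true) =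
      tape k (update s r (s r + 1)) := by
  funext j
  cases j with
  | zero => rfl
  | succ j =>
    simp only [update_apply, tape, setMark, Option.map_some]
    split_ifs with h
    · simp only [Option.some.injEq]
      funext i
      have : j = s r := by omega
      split_ifs with hi <;> simp [this]
    · simp only [Option.some.injEq]
      funext i
      split_ifs with hi
      · rw [hi, decide_eq_decide]
        omega
      · rfl

theorem update_tape_dec (k : ℕ) (s : ℕ → ℕ) (r v : ℕ) (hv : s r = v + 1) :
    update (tape k s) (v + 1) (setMark (tape k s (v + 1)) r false) =
      tape k (update s r v) := by
  funext j
  cases j with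
  | zero => rfl
  | succ j =>
    simp only [update_apply, tape, setMark, Option.map_some]
    split_ifs with h
    · simp only [Option.some.injEq]
      funext i
      have : j = v := by omega
      split_ifs with hi <;> simp [this]
    · simp only [Option.some.injEq]
      funext i
      split_ifs with hi
      · rw [hi, decide_eq_decide]
        omega
      · rfl

theorem tape_single (k x j : ℕ) :
    tape k (Pi.single 0 x) (j + 1) = if j < x then oneSymbol k else blankSymbol k := by
  rw [tape, oneSymbol, blankSymbol, ← apply_ite some]
  congr 1
  funext r
  by_cases hr : r.val = 0
  · split_ifs with h <;> simp [hr, h]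
  · split_ifs with h <;> simp [hr]

section Simulation

variable {m n : ℕ} {code : List RegInstr} {e : TrackSymbol k ≃ Fin (m + 2)}
  {e' : ControlState code.length ≃ Fin (n + 2)}

/-- The relation `Leads` of the simulating machine, in terms of its own symbols and states. -/
def SimLeads (k : ℕ) (code : List RegInstr) (e : TrackSymbol k ≃ Fin (m + 2))
    (e' : ControlState code.length ≃ Fin (n + 2))
    (f : ℕ → TrackSymbol k) (q : ControlState code.length) (i : ℕ)
    (f' : ℕ → TrackSymbol k) (q' : ControlState code.length) (i' : ℕ) : Prop :=
  ∀ h, (ofProgram e e' (simulator k code) h).Leads (e ∘ f) (e' q) i (e ∘ f') (e' q') i'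

theorem SimLeads.trans {f f' f'' : ℕ → TrackSymbol k} {q q' q'' : ControlState code.length}
    {i i' i'' : ℕ} (h : SimLeads k code e e' f q i f' q' i')
    (h' : SimLeads k code e e' f' q' i' f'' q'' i'') : SimLeads k code e e' f q i f'' q'' i'' :=
  fun hP => (h hP).trans (h' hP)

theorem simLeads_write {f : ℕ → TrackSymbol k} {q q' : ControlState code.length} {i : ℕ}
    {b : TrackSymbol k} (h : simulator k code q (f i) = some (q', .write b)) :
    SimLeads k code e e' f q i (update f i b) q' i := by
  intro hP
  rw [comp_update]
  exact leads_write (program_ofProgram hP h)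

theorem simLeads_right {f : ℕ → TrackSymbol k} {q q' : ControlState code.length} {i : ℕ}
    (h : simulator k code q (f i) = some (q', .move .right)) :
    SimLeads k code e e' f q i f q' (i + 1) :=
  fun hP => leads_right (program_ofProgram hP h)

theorem simLeads_left {f : ℕ → TrackSymbol k} {q q' : ControlState code.length} {i : ℕ}
    (h : simulator k code q (f (i + 1)) = some (q', .move .left)) :
    SimLeads k code e e' f q (i + 1) f q' i :=
  fun hP => leads_left (program_ofProgram hP h)

theorem simLeads_home {pc : ℕ} {ins : RegInstr} (hpc : code[pc]? = some ins)
    (f : ℕ → TrackSymbol k) :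
    SimLeads k code e e' f (control _ pc .home) 0 f (control _ pc .seek) 1 := by
  have hlt : pc < code.length + 1 := (List.getElem?_eq_some_iff.1 hpc).1.trans (Nat.lt_succ_self _)
  refine simLeads_right ?_
  simp [control, simulator, Nat.mod_eq_of_lt hlt, hpc]

/-- Marks on a track form an initial segment, so the head runs over them up to the first unmarked
cell. Tests are excluded because they inspect the first cell only. -/
theorem simLeads_seek {pc : ℕ} {ins : RegInstr} (hpc : code[pc]? = some ins)
    (hr : ins.reg < k) (hins : ∀ l₀ l₁, ins ≠ test ins.reg l₀ l₁) (s : ℕ → ℕ) {j : ℕ}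
    (hj : j ≤ s ins.reg) :
    SimLeads k code e e' (tape k s) (control _ pc .home) 0 (tape k s) (control _ pc .seek)
      (j + 1) := by
  have hlt : pc < code.length + 1 := (List.getElem?_eq_some_iff.1 hpc).1.trans (Nat.lt_succ_self _)
  induction j with
  | zero => exact simLeads_home hpc _
  | succ j ih =>
    refine (ih (by omega)).trans (simLeads_right ?_)
    have hm := isMarked_tape hr s j
    rw [decide_eq_true (by omega)] at hm
    cases ins with
    | test r l₀ l₁ => exact (hins _ _ rfl).elim
    | inc r | dec r =>
      rw [reg] at hm
      simp [control, simulator, Nat.mod_eq_of_lt hlt, hpc, hm]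

theorem simLeads_back {pc : ℕ} (hpc : pc < code.length) (s : ℕ → ℕ) (j : ℕ) :
    SimLeads k code e e' (tape k s) (control _ pc .back) j (tape k s) (control _ (pc + 1) .home)
      0 := by
  have hlt : pc < code.length + 1 := hpc.trans (Nat.lt_succ_self _)
  induction j with
  | zero =>
    have h : SimLeads k code e e' (tape k s) (control _ pc .back) 0 (update (tape k s) 0 none)
        (control _ (pc + 1) .home) 0 := by
      refine simLeads_write ?_
      simp [control, simulator, tape, Nat.mod_eq_of_lt hlt]
    rwa [show (none : TrackSymbol k) = tape k s 0 from rfl, update_eq_self] at h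
  | succ j ih =>
    refine (simLeads_left ?_).trans ih
    simp [control, simulator, tape, Nat.mod_eq_of_lt hlt]

/-- Each step of the register machine is simulated by the Turing machine. -/
theorem Step.simLeads (hk : ∀ ins ∈ code, ins.reg < k) {c d : ℕ × (ℕ → ℕ)}
    (h : Step code c d) :
    SimLeads k code e e' (tape k c.2) (control _ c.1 .home) 0 (tape k d.2)
      (control _ d.1 .home) 0 := by
  cases h with
  | @inc pc r s h =>
    have hlt := (List.getElem?_eq_some_iff.1 h).1
    have hr : r < k := hk _ (List.mem_of_getElem? h)
    refine (simLeads_seek h hr (by simp) s le_rfl).trans ?_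
    refine SimLeads.trans ?_ (simLeads_back hlt _ (s r + 1))
    rw [← update_tape_inc]
    refine simLeads_write ?_
    have hm := isMarked_tape hr s (s r)
    simp only [lt_irrefl, decide_false] at hm
    simp [control, simulator, Nat.mod_eq_of_lt (hlt.trans (Nat.lt_succ_self _)), h, hm, reg]
  | @dec pc r s h =>
    have hlt := (List.getElem?_eq_some_iff.1 h).1
    have hr : r < k := hk _ (List.mem_of_getElem? h)
    have hm := isMarked_tape hr s (s r)
    simp only [lt_irrefl, decide_false] at hm
    refine (simLeads_seek h hr (by simp) s le_rfl).trans ?_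
    -- The first unmarked cell has number `s r + 1`; one cell to the left is the last marked cell,
    -- or the beginning of the tape if the register is zero.
    refine SimLeads.trans (q' := control _ pc .erase) (simLeads_left (i := s r) ?_) ?_
    · simp [control, simulator, Nat.mod_eq_of_lt (hlt.trans (Nat.lt_succ_self _)), h, hm]
    · cases hv : s r with
      | zero =>
        have h1 : SimLeads k code e e' (tape k s) (control _ pc .erase) 0
            (update (tape k s) 0 none) (control _ (pc + 1) .home) 0 := by
          refine simLeads_write ?_
          simp [control, simulator, tape, Nat.mod_eq_of_lt (hlt.trans (Nat.lt_succ_self _)), h]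
        rw [show (none : TrackSymbol k) = tape k s 0 from rfl, update_eq_self] at h1
        rwa [Nat.zero_sub, ← hv, update_eq_self, hv]
      | succ v =>
        refine SimLeads.trans ?_ (simLeads_back hlt _ (v + 1))
        rw [Nat.add_sub_cancel, ← update_tape_dec k s r v hv]
        refine simLeads_write ?_
        simp [control, simulator, tape, Nat.mod_eq_of_lt (hlt.trans (Nat.lt_succ_self _)), h]
  | @test_zero pc r l₀ l₁ s h hl hs =>
    have hlt := (List.getElem?_eq_some_iff.1 h).1
    have hr : r < k := hk _ (List.mem_of_getElem? h)
    have hm := isMarked_tape hr s 0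
    refine (simLeads_home h _).trans (simLeads_left ?_)
    simp [hs] at hm
    simp [control, simulator, Nat.mod_eq_of_lt (hlt.trans (Nat.lt_succ_self _)), h, hm]
  | @test_ne_zero pc r l₀ l₁ s h hl hs =>
    have hlt := (List.getElem?_eq_some_iff.1 h).1
    have hr : r < k := hk _ (List.mem_of_getElem? h)
    have hm := isMarked_tape hr s 0
    refine (simLeads_home h _).trans (simLeads_left ?_)
    simp [Nat.pos_of_ne_zero hs] at hm
    simp [control, simulator, Nat.mod_eq_of_lt (hlt.trans (Nat.lt_succ_self _)), h, hm]

theorem simLeads_of_transGen (hk : ∀ ins ∈ code, ins.reg < k) {c d : ℕ × (ℕ → ℕ)}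
    (h : TransGen (Step code) c d) :
    SimLeads k code e e' (tape k c.2) (control _ c.1 .home) 0 (tape k d.2)
      (control _ d.1 .home) 0 := by
  induction h with
  | single h => exact h.simLeads hk
  | tail _ h ih => exact ih.trans (h.simLeads hk)

end Simulation

/-- For every list of instructions there is a Turing machine that transforms the tape in the same
way as the register machine, with the argument and the value in register `0`. -/
theorem exists_turingMachine (code : List RegInstr) :
    ∃ (m n : ℕ) (T : TuringMachine m n),
      (∀ x y, ReflTransGen (Step code) (0, Pi.single 0 x) (code.length, Pi.single 0 y) →
        ∃ s, ReflTransGen T.StepNoExt (initial m n x) (final m n y s)) ∧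
      ∀ (x : ℕ) (P : ℕ × (ℕ → ℕ) → Prop),
        (∀ c, P c → ∃ d, TransGen (Step code) c d ∧ P d) →
        (∃ c, ReflTransGen (Step code) (0, Pi.single 0 x) c ∧ P c) →
        ∀ c, ReflTransGen T.Step (initial m n x) c → ¬ T.Halted c := by
  obtain ⟨k, hk0, hk⟩ : ∃ k, 0 < k ∧ ∀ ins ∈ code, ins.reg < k := by
    -- The sum is a convenient upper bound for all registers; adding one also provides track `0`,
    -- which separates the blank from the symbol one.
    refine ⟨(code.map reg).sum + 1, by omega, fun ins h => ?_⟩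
    exact Nat.lt_succ_of_le (List.le_sum_of_mem (List.mem_map_of_mem h))
  have hbo : blankSymbol k ≠ oneSymbol k := by
    intro h
    have := congrFun (Option.some.inj h) ⟨0, hk0⟩
    simp at this
  obtain ⟨m, e, he0, he1⟩ := exists_equiv_fin hbo
  obtain ⟨n, e', he0', he1'⟩ := exists_equiv_fin
    (show (none : ControlState code.length) ≠ some none by simp)
  have hP : ∀ a, simulator k code (e'.symm 0) a = none := by
    intro a
    rw [← he0', Equiv.symm_apply_apply]
    rfl
  have hcell : ∀ x j, e (update (tape k (Pi.single 0 x)) 0 (blankSymbol k) (j + 1)) =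
      if j < x then 1 else 0 := by
    intro x j
    rw [update_of_ne (by omega), tape_single, apply_ite e, he0, he1]
  have hini : ∀ x, HasTape (e ∘ update (tape k (Pi.single 0 x)) 0 (blankSymbol k))
      (e' (some none)) 0 (initial m n x) := by
    intro x
    refine ⟨x, fun j hj => ?_, ?_⟩
    · obtain ⟨j, rfl⟩ := Nat.exists_eq_add_of_le' (show 1 ≤ j by omega)
      rw [comp_apply, hcell, if_neg (by omega)]
    · rw [he1', comp_apply, update_self, he0, initial]
      congr 1
      refine (List.eq_replicate_iff.2 ⟨by simp, fun a ha => ?_⟩).symm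
      obtain ⟨j, hj, rfl⟩ := List.mem_map.1 ha
      rw [List.mem_range'_1] at hj
      obtain ⟨j, rfl⟩ := Nat.exists_eq_add_of_le' (show 1 ≤ j by omega)
      rw [comp_apply, hcell, if_pos (by omega)]
  -- The word `0 1^x` already represents the argument in unary on track `0`; only its first cell has
  -- to become the mark of the beginning.
  have hstart : ∀ x, SimLeads k code e e' (update (tape k (Pi.single 0 x)) 0 (blankSymbol k))
      (some none) 0 (tape k (Pi.single 0 x)) (control _ 0 .home) 0 := by
    intro x
    have h : SimLeads k code e e' (update (tape k (Pi.single 0 x)) 0 (blankSymbol k))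
      (some none) 0 (update (update (tape k (Pi.single 0 x)) 0 (blankSymbol k)) 0 none)
        (control _ 0 .home) 0 := simLeads_write rfl
    rwa [update_idem, show (none : TrackSymbol k) = tape k (Pi.single 0 x) 0 from rfl,
      update_eq_self] at h
  have hreach : ∀ x c, ReflTransGen (Step code) (0, Pi.single 0 x) c →
      SimLeads k code e e' (update (tape k (Pi.single 0 x)) 0 (blankSymbol k))
        (some none) 0 (tape k c.2) (control _ c.1 .home) 0 := by
    intro x c h
    rcases reflTransGen_iff_eq_or_transGen.1 h with rfl | h
    · exact hstart x
    · exact (hstart x).trans (simLeads_of_transGen hk h)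
  refine ⟨m, n, ofProgram e e' (simulator k code) hP, ?_, ?_⟩
  · intro x y h
    have h1 : SimLeads k code e e' (tape k (Pi.single 0 y)) (control _ code.length .home) 0
        (update (tape k (Pi.single 0 y)) 0 (blankSymbol k)) none 0 := by
      refine simLeads_write ?_
      simp [control, simulator]
    obtain ⟨d, hd, l, hl, rfl⟩ := (((hreach x _ h).trans h1) hP) _ (hini x)
    -- All `y` ones lie on the finite tape, because cells beyond it are blank; the other `l - y`
    -- cells are the trailing blanks.
    have hyl : y ≤ l := by
      by_contra hlt
      have h2 := hl (l + 1) (by omega)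
      rw [comp_apply, hcell, if_pos (by omega)] at h2
      simp at h2
    refine ⟨l - y, ?_⟩
    convert hd.to_reflTransGen using 1
    rw [he0', comp_apply, update_self, he0, final]
    congr 1
    have hsplit : List.range' (0 + 1) l = List.range' 1 y ++ List.range' (1 + y) (l - y) := by
      rw [List.range'_append_1, Nat.add_sub_cancel' hyl]
    rw [hsplit, List.map_append]
    congr 1
    · refine (List.eq_replicate_iff.2 ⟨by simp, fun a ha => ?_⟩).symm
      obtain ⟨j, hj, rfl⟩ := List.mem_map.1 ha
      rw [List.mem_range'_1] at hj
      obtain ⟨j, rfl⟩ := Nat.exists_eq_add_of_le' (show 1 ≤ j by omega)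
      rw [comp_apply, hcell, if_pos (by omega)]
    · refine (List.eq_replicate_iff.2 ⟨by simp, fun a ha => ?_⟩).symm
      obtain ⟨j, hj, rfl⟩ := List.mem_map.1 ha
      rw [List.mem_range'_1] at hj
      obtain ⟨j, rfl⟩ := Nat.exists_eq_add_of_le' (show 1 ≤ j by omega)
      rw [comp_apply, hcell, if_neg (by omega)]
  · rintro x P hPs ⟨c₀, hc₀, hPc₀⟩ d hd
    refine not_halted_of_forall_transGen (c := initial m n x)
      -- The initial configuration does not represent a register state, so it joins the invariant
      -- separately.
      (P := fun c => c = initial m n x ∨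
        ∃ a, P a ∧ HasTape (e ∘ tape k a.2) (e' (control _ a.1 .home)) 0 c)
      ?_ (.inl rfl) hd
    rintro c (rfl | ⟨a, ha, hc⟩)
    · obtain ⟨d₀, hd₀, hdt⟩ := hreach x _ hc₀ hP _ (hini x)
      exact ⟨d₀, TransGen.mono (fun _ _ => TuringMachine.Step.noExt) _ _ hd₀, .inr ⟨c₀, hPc₀, hdt⟩⟩
    · obtain ⟨b, hab, hb⟩ := hPs a ha
      obtain ⟨d₀, hd₀, hdt⟩ := simLeads_of_transGen hk hab hP _ hc
      exact ⟨d₀, TransGen.mono (fun _ _ => TuringMachine.Step.noExt) _ _ hd₀, .inr ⟨b, hb, hdt⟩⟩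

end RegInstr

/-! ### Unbounded search -/

namespace RegProgram

open Function

/-- The register contents during the search. -/
def searchState (x n z : ℕ) : ℕ → ℕ := update (update (Pi.single 0 x) 1 n) 3 z

/-- The body of the search: increase register `1` and run the test, with its result in
register `3`. -/
def searchBody (p : RegProgram) : RegProgram := seq (inc 1) (seq (clear 3) p)

theorem exec_searchBody {p : RegProgram} {t : ℕ → ℕ → ℕ}
    (hp : ComputesInto p (fun v : List.Vector ℕ 2 => t v.head v.tail.head) ![0, 1] 3 4)
    (x n z : ℕ) :
    Exec (searchBody p) (searchState x n z) (searchState x (n + 1) (t x (n + 1))) := by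
  have h1 : Exec (inc 1) (searchState x n z) (searchState x (n + 1) z) := by
    refine (Exec.inc _ _).of_eq ?_
    funext r
    simp only [searchState, update_apply]
    grind
  have h2 : Exec (clear 3) (searchState x (n + 1) z) (searchState x (n + 1) 0) :=
    (exec_clear _ _).of_eq (by simp [searchState])
  refine .seq h1 (.seq h2 ((hp _ (fun r hr => ?_) ?_).of_eq ?_))
  · simp only [searchState, update_apply, Pi.single_apply]
    grind
  · simp [searchState]
  · simp [searchState, List.Vector.ofFn]

/-- Induction on the distance `d` to a known zero. The search may stop at an earlier zero, so only
some zero `i` is asserted. -/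
theorem exists_exec_loop_search {p : RegProgram} {t : ℕ → ℕ → ℕ}
    (hp : ComputesInto p (fun v : List.Vector ℕ 2 => t v.head v.tail.head) ![0, 1] 3 4)
    {x d n z : ℕ} (hd : t x (n + d + 1) = 0) (hz : z ≠ 0) :
    ∃ i, t x i = 0 ∧ Exec (loop 3 (searchBody p)) (searchState x n z) (searchState x i 0) := by
  induction d generalizing n z with
  | zero =>
    have h := exec_searchBody hp x n z
    rw [show t x (n + 1) = 0 from hd] at h
    exact ⟨n + 1, hd, .loop_step (by simpa [searchState]) h (.loop_zero (by simp [searchState]))⟩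
  | succ d ih =>
    have h := exec_searchBody hp x n z
    by_cases ht : t x (n + 1) = 0
    · rw [ht] at h
      exact ⟨n + 1, ht, .loop_step (by simpa [searchState]) h (.loop_zero (by simp [searchState]))⟩
    · obtain ⟨i, hi, hi'⟩ := ih (n := n + 1) (by rw [← hd]; congr 1; omega) ht
      exact ⟨i, hi, .loop_step (by simpa [searchState]) h hi'⟩

end RegProgram

namespace TuringMachine

open RegProgram Relation Function

/-- A partial function that is given by an unbounded search with primitive recursive data is
computed by a Turing machine. -/
theorem exists_computes_of_search {E : ℕ →. ℕ} {t v : ℕ → ℕ → ℕ} (ht : Primrec₂ t)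
    (hv : Primrec₂ v) (hdom : ∀ x, (E x).Dom ↔ ∃ i, t x (i + 1) = 0)
    (hE : ∀ x i, t x i = 0 → v x i ∈ E x) :
    ∃ (m n : ℕ) (T : TuringMachine m n), T.Computes E := by
  have hins : ∀ b, 2 ≤ b → ∀ i, (![0, 1] : Fin 2 → ℕ) i < b := by
    intro b hb i
    fin_cases i <;> simp <;> omega
  have hne : ∀ b, 2 ≤ b → ∀ i, (![0, 1] : Fin 2 → ℕ) i ≠ b := fun b hb i => (hins b hb i).ne
  obtain ⟨pt, hpt⟩ := exists_computesInto (Nat.Primrec'.prim_iff₂.2 ht) ![0, 1] 3 4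
    (hins 4 (by omega)) (by omega) (hne 3 (by omega))
  obtain ⟨pv, hpv⟩ := exists_computesInto (Nat.Primrec'.prim_iff₂.2 hv) ![0, 1] 2 4
    (hins 4 (by omega)) (by omega) (hne 2 (by omega))
  let q := seq pv (seq (clear 0) (seq (clear 1) (move 2 0)))
  let p := seq (inc 3) (seq (loop 3 (searchBody pt)) q)
  have hp : p.IsPartOf (p.compile 0) 0 := ⟨[], [], by simp, rfl⟩
  -- A nonzero register `3` forces entry into the loop. The counter is increased before each test,
  -- so the search begins at `1`.
  have hinc : ∀ x, Exec (inc 3) (Pi.single 0 x) (searchState x 0 1) := by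
    intro x
    refine (Exec.inc _ _).of_eq ?_
    funext r
    simp only [searchState, update_apply, Pi.single_apply]
    grind
  obtain ⟨m, n, T, hT, hT'⟩ := RegInstr.exists_turingMachine (p.compile 0)
  refine ⟨m, n, T, fun x => ⟨fun y hy => hT x y ?_, fun hx => ?_⟩⟩
  · obtain ⟨d, hd⟩ := (hdom x).1 (Part.dom_iff_mem.2 ⟨y, hy⟩)
    obtain ⟨i, hi, hi'⟩ := exists_exec_loop_search hpt (n := 0) (d := d) (by rwa [zero_add])
      one_ne_zero
    have hpv' : Exec pv (searchState x i 0) (update (searchState x i 0) 2 (v x i)) := by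
      refine (hpv _ (fun r hr => ?_) ?_).of_eq ?_
      · simp only [searchState, update_apply, Pi.single_apply]
        grind
      · simp [searchState]
      · simp [searchState, List.Vector.ofFn]
    obtain rfl := Part.mem_unique hy (hE x i hi)
    have h : Exec p (Pi.single 0 x) (Pi.single 0 (v x i)) := by
      refine (Exec.seq (hinc x) (.seq hi' (.seq hpv' (.seq (exec_clear _ _)
        (.seq (exec_clear _ _) (exec_move (by omega) _)))))).of_eq ?_
      funext r
      simp only [searchState, update_apply, Pi.single_apply]
      grind
    have h' := h.reflTransGen hp
    rwa [zero_add, ← length_compile p 0] at h'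
  -- The loop begins at address `1`, after `inc 3`. Without a zero each round returns there with
  -- register `3` nonzero.
  · refine hT' x (fun c => ∃ i z, z ≠ 0 ∧ c = (1, searchState x i z)) ?_
      ⟨_, (hinc x).reflTransGen hp.left, 0, 1, one_ne_zero, rfl⟩
    rintro _ ⟨i, z, hz, rfl⟩
    refine ⟨_, hp.right.left.loop_transGen (by simpa [searchState]) (exec_searchBody hpt x i z),
      i + 1, _, fun h => hx ((hdom x).2 ⟨i, h⟩), rfl⟩

end TuringMachine

/-! ### An inextensible function -/

open Nat.Partrec (Code)
open Denumerable (ofNat)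

/-- The diagonal function: `1` if the program with number `x` has the value `0` at `x`, `0` if it has
another value, and undefined if it has none. -/
def diagonal : ℕ →. ℕ := fun x => ((ofNat Code x).eval x).map fun y => 1 - y

/-- A total recursive extension `f` with program `c` would satisfy `f c = 1 - f c` at the number of
`c`, which no natural number does, even with truncated subtraction. -/
theorem isInextensible_diagonal : IsInextensible diagonal where
  partrec := by
    refine Partrec.map (Code.eval_part.comp (Computable.ofNat Code) Computable.id) ?_
    exact (Primrec.nat_sub.comp (Primrec.const 1) Primrec.snd).to_comp.to₂
  zero_or_one := by
    intro x y hy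
    obtain ⟨z, -, rfl⟩ := (Part.mem_map_iff _).1 hy
    omega
  no_extension := by
    rintro ⟨f, hf, hfe⟩
    obtain ⟨c, hc⟩ := Code.exists_code.1 (Partrec.nat_iff.1 hf.partrec)
    have h : 1 - f (Encodable.encode c) ∈ diagonal (Encodable.encode c) := by
      refine (Part.mem_map_iff _).2 ⟨f (Encodable.encode c), ?_, rfl⟩
      rw [Denumerable.ofNat_encode, hc]
      exact Part.mem_some _
    have := hfe _ _ h
    omega

/-- Evaluation with bound `i` is primitive recursive, and a value exists if and only if some bound
finds it. The test is `0` once a value is found and `1` before. -/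
theorem exists_computes_diagonal :
    ∃ (m n : ℕ) (T : TuringMachine m n), T.Computes diagonal := by
  have he : Primrec₂ fun x i : ℕ => (ofNat Code x).evaln i x :=
    (Code.primrec_evaln.comp ((Primrec.snd.pair ((Primrec.ofNat Code).comp Primrec.fst)).pair
      Primrec.fst)).to₂
  have ht : Primrec₂ fun x i : ℕ => (((ofNat Code x).evaln i x).map fun _ => 0).getD 1 :=
    (Primrec.option_getD.comp (Primrec.option_map he (Primrec.const 0).to₂) (Primrec.const 1)).to₂
  have hv : Primrec₂ fun x i : ℕ => 1 - ((ofNat Code x).evaln i x).getD 0 :=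
    (Primrec.nat_sub.comp (Primrec.const 1)
      (Primrec.option_getD.comp he (Primrec.const 0))).to₂
  have hzero : ∀ x i : ℕ, (((ofNat Code x).evaln i x).map fun _ => 0).getD 1 = 0 ↔
      ∃ y, y ∈ (ofNat Code x).evaln i x := by
    intro x i
    cases (ofNat Code x).evaln i x <;> simp
  refine TuringMachine.exists_computes_of_search ht hv (fun x => ?_) fun x i hi => ?_
  · simp only [hzero]
    change ((ofNat Code x).eval x).Dom ↔ _
    rw [Part.dom_iff_mem]
    constructor
    · rintro ⟨y, hy⟩
      obtain ⟨i, hi⟩ := Code.evaln_complete.1 hy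
      -- Bound `0` is never tried; monotonicity in the bound makes this harmless.
      exact ⟨i, y, Code.evaln_mono (Nat.le_succ i) hi⟩
    · rintro ⟨i, y, hy⟩
      exact ⟨y, Code.evaln_sound hy⟩
  · obtain ⟨y, hy⟩ := (hzero x i).1 hi
    rw [Option.mem_def.1 hy]
    exact (Part.mem_map_iff _).2 ⟨y, Code.evaln_sound hy, rfl⟩

/-! ### The theorem of Post and Markov -/

theorem mainTheorem2 :
    -- for every machine `T` that computes a 0/1-valued `E` without recursive extension
    (∀ (m n : ℕ) (T : TuringMachine m n) (E : ℕ →. ℕ), IsInextensible E → T.Computes E →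
      (∀ i : ℕ, i = 0 ∨ i = 1 →
        REPred (fun x : ℕ => i ∈ E x) ∧ ¬ ComputablePred (fun x : ℕ => i ∈ E x) ∧
        ∀ x : ℕ, T.calculus.Equivalent (TuringMachine.word m 1 x) (TuringMachine.word m 0 i) ↔
          i ∈ E x) ∧
      ¬ T.calculus.WordProblemDecidable) ∧
    -- such machines exist
    (∃ (m n : ℕ) (T : TuringMachine m n) (E : ℕ →. ℕ), IsInextensible E ∧ T.Computes E) ∧
    -- hence there is an associative calculus with undecidable word problem
    (∃ (k : ℕ) (C : AssociativeCalculus (Fin k)), ¬ C.WordProblemDecidable) := by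
  obtain ⟨m, n, T, hT⟩ := exists_computes_diagonal
  refine ⟨fun m n T E hE hT => ⟨fun i hi => ⟨hE.rePred i, hE.not_computablePred hi, fun x =>
    TuringMachine.equivalent_iff_mem hT x i⟩, hE.not_wordProblemDecidable hT⟩,
    ⟨m, n, T, diagonal, isInextensible_diagonal, hT⟩, ?_⟩
  let e := Fintype.equivFin (TuringMachine.Letter m n)
  exact ⟨_, T.calculus.rename e, fun h =>
    isInextensible_diagonal.not_wordProblemDecidable hT (.of_rename e h)⟩
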